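/- Let $n\ge 2$. For a Lebesgue measurable set $E\subset\mathbb{R}^n$ let $P(E)=\sup\{\int_E \operatorname{div}\xi\,dx : \xi\in C^1_c(\mathbb{R}^n;\mathbb{R}^n),\ |\xi|\le 1\}\in[0,\infty]$ be its perimeter in $\mathbb{R}^n$, and for $v\in L^1(\mathbb{R}^n)$ let $\int_{\mathbb{R}^n}|Dv|=\sup\{\int v\operatorname{div}\xi\,dx : \xi\in C^1_c(\mathbb{R}^n;\mathbb{R}^n),\ |\xi|\le 1\}$; $v\in BV(\mathbb{R}^n)$ means $v\in L^1(\mathbb{R}^n)$ and $\int_{\mathbb{R}^n}|Dv|<\infty$. Let $\partial^*E$ denote the reduced boundary of $E$. For $h>0$ put $$\mathcal F_h(E,F)=P(E)+\frac1h\int_{E\Delta F} d_F\,dx,\qquad d_F(x)=\operatorname{dist}(x,\partial F),$$ with $\operatorname{dist}(x,\emptyset)=+\infty$. Let $\Omega\subset\mathbb{R}^n$ and let $E_0\subset\subset\Omega$ (i.e. $\overline{E_0}$ is compact and contained in the interior of $\Omega$) be a Lebesgue measurable set, represented so that $\overline{\partial^*E_0}=\partial E_0$, which is outward minimizing in $\Omega$: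 $$P(E_0)\le P(F)\quad\text{for all measurable } F \text{ with } E_0\subset F\subset\Omega .$$ Then there exists $h_0>0$ such that for every $0<h<h_0$ the following holds. Let $E_1,E_2,\dots$ be any measurable sets such that, for each $k\ge1$, $E_k$ minimizes $\mathcal F_h(\,\cdot\,,E_{k-1})$ among all measurable subsets of $\mathbb{R}^n$ and is represented so that $\overline{\partial^*E_k}=\partial E_k$. Then the discrete arrival time $$u_h(x)=h\sum_{k\ge0}\chi_{E_k}(x)\qquad(x\in\mathbb{R}^n)$$ is finite everywhere, belongs to $BV(\mathbb{R}^n)$, and is outward minimizing in $\Omega$ in the sense that $$\int_{\mathbb{R}^n}|Du_h|\le\int_{\mathbb{R}^n}|Dv|\quad\text{for all } v\in BV(\mathbb{R}^n)\text{ with } v\ge u_h \text{ a.e. and } v=0 \text{ a.e. in }\mathbb{R}^n\setminus\Omega .$$ -/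

import Mathlib

open MeasureTheory Set Filter Topology
open scoped ENNReal

noncomputable section

namespace ATW

/-- Euclidean space `ℝⁿ`. -/
abbrev Rn (n : ℕ) : Type := EuclideanSpace ℝ (Fin n)

/-- The divergence `∑ᵢ ∂ᵢ ξᵢ` of a vector field. -/
def divergence {n : ℕ} (ξ : Rn n → Rn n) (x : Rn n) : ℝ :=
  ∑ i : Fin n, (fderiv ℝ ξ x (EuclideanSpace.single i 1)) i

/-- Vector fields of class `C¹` with compact support. -/
def IsTestField {n : ℕ} (ξ : Rn n → Rn n) : Prop :=
  ContDiff ℝ 1 ξ ∧ HasCompactSupport ξ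

/-- The total variation `∫ |Dv|` over `ℝⁿ` of a locally integrable function `v`: the supremum of
`∫ v div ξ` over all `ξ ∈ C¹_c(ℝⁿ; ℝⁿ)` with `|ξ| ≤ 1`. (Since `ξ = 0` is allowed,
nothing is lost by replacing negative numbers by `0`.) -/
def totalVariation {n : ℕ} (v : Rn n → ℝ) : ℝ≥0∞ :=
  ⨆ (ξ : Rn n → Rn n) (_ : IsTestField ξ ∧ ∀ x, ‖ξ x‖ ≤ 1),
    ENNReal.ofReal (∫ x, v x * divergence ξ x)

/-- `v ∈ BV(ℝⁿ)`: `v` is in `L¹` and has finite total variation. -/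
def MemBV {n : ℕ} (v : Rn n → ℝ) : Prop :=
  Integrable v ∧ totalVariation v < ∞

/-- The De Giorgi perimeter in `ℝⁿ` of a Lebesgue measurable set: the supremum of `∫_E div ξ`
over all `ξ ∈ C¹_c(ℝⁿ; ℝⁿ)` with `|ξ| ≤ 1`. -/
def perimeter {n : ℕ} (E : Set (Rn n)) : ℝ≥0∞ :=
  ⨆ (ξ : Rn n → Rn n) (_ : IsTestField ξ ∧ ∀ x, ‖ξ x‖ ≤ 1),
    ENNReal.ofReal (∫ x in E, divergence ξ x)

/-- `E` is outward minimizing in `Ω`. (`NullMeasurableSet` is Lebesgue measurability.) -/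
def IsOutwardMinimizing {n : ℕ} (Ω E : Set (Rn n)) : Prop :=
  NullMeasurableSet E ∧ E ⊆ Ω ∧
    ∀ F : Set (Rn n), NullMeasurableSet F → E ⊆ F → F ⊆ Ω → perimeter E ≤ perimeter F

/-- `m = |μ_E|` and `ν` are the polar decomposition `μ_E = ν m` of the Gauss-Green measure of `E`,
that is, `m` is a Radon measure, `|ν| = 1` holds `m`-a.e., and
`∫_E div ξ = ∫ ξ · ν dm` for all `ξ ∈ C¹_c(ℝⁿ; ℝⁿ)`. Such a pair exists exactly if `E` has locally
finite perimeter; then `m` is unique and `ν` is unique `m`-a.e. -/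
def IsGaussGreen {n : ℕ} (E : Set (Rn n)) (m : Measure (Rn n)) (ν : Rn n → Rn n) : Prop :=
  IsLocallyFiniteMeasure m ∧ Measurable ν ∧ (∀ᵐ x ∂m, ‖ν x‖ = 1) ∧
    ∀ ξ : Rn n → Rn n, IsTestField ξ →
      ∫ x in E, divergence ξ x = ∫ x, inner ℝ (ξ x) (ν x) ∂m

/-- The reduced boundary `∂*E`: the points `x` in the support of `|μ_E|` at which
`μ_E(B_r(x)) / |μ_E|(B_r(x))` converges to a unit vector as `r ↓ 0`. -/
def reducedBoundary {n : ℕ} (E : Set (Rn n)) : Set (Rn n) :=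
  {x | ∃ (m : Measure (Rn n)) (ν : Rn n → Rn n), IsGaussGreen E m ν ∧
    (∀ r : ℝ, 0 < r → 0 < m (Metric.ball x r)) ∧
    ∃ e : Rn n, ‖e‖ = 1 ∧
      Tendsto (fun r : ℝ => (m.real (Metric.ball x r))⁻¹ • ∫ y in Metric.ball x r, ν y ∂m)
        (𝓝[>] 0) (𝓝 e)}

/-- `E` is a representative (in its Lebesgue class) with `closure (∂*E) = ∂E`. -/
def IsNormalized {n : ℕ} (E : Set (Rn n)) : Prop :=
  closure (reducedBoundary E) = frontier E

/-- The functional `F_h(E, F) = P(E) + (1/h) ∫_{E Δ F} d_F`, where `d_F` is the distance to the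
topological boundary of `F` (`+∞` if that boundary is empty). -/
def stepFunctional {n : ℕ} (h : ℝ) (E F : Set (Rn n)) : ℝ≥0∞ :=
  perimeter E + ENNReal.ofReal (1 / h) *
    ∫⁻ x in symmDiff E F, Metric.infEDist x (frontier F)

/-- The sets `E 0, E 1, E 2, …` are an implicit time discretization with time step `h`: each
`E (k + 1)` minimizes `F_h(·, E k)` among all Lebesgue measurable sets, and is represented so that
`closure (∂*E) = ∂E`. -/
def IsScheme {n : ℕ} (h : ℝ) (E : ℕ → Set (Rn n)) : Prop :=
  ∀ k : ℕ, NullMeasurableSet (E (k + 1)) ∧ IsNormalized (E (k + 1)) ∧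
    ∀ F : Set (Rn n), NullMeasurableSet F →
      stepFunctional h (E (k + 1)) (E k) ≤ stepFunctional h F (E k)

/-- The arrival time `u_h = h ∑_{k ≥ 0} χ_{E_k}`, a priori with values in `[0, ∞]`. -/
def arrivalTime {n : ℕ} (h : ℝ) (E : ℕ → Set (Rn n)) (x : Rn n) : ℝ≥0∞ :=
  ENNReal.ofReal h * ∑' k : ℕ, (E k).indicator (fun _ => (1 : ℝ≥0∞)) x

end ATW

end

/-! The arrival time is `h` times a sum of indicators, so its total variation is at most the sum of
`h P(E_j)`. By the coarea inequality a competitor `v` has variation at least `∫ P({v > t}) dt`. If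
the `E_j` are nested up to null sets, then for `hj ≤ t < h(j+1)` the set `{v > t}` contains `E_j`
and lies in `Ω`, almost everywhere; if `E_j` is outward minimizing, then `P(E_j) ≤ P({v > t})`, and
summing over `j` gives the claim. It remains to show that every `E_j` is outward minimizing, that
the sets are nested, and that they are eventually empty.

Inheritance (`IsStepMinimizer.isOutwardMinimizing`): let `G` be a minimizer with datum `E`. For `G ⊆
F ⊆ Ω` the set `F ∩ E` has no more dissipation than `G`, so `P(G) ≤ P(F ∩ E)`; submodularity of the
perimeter and outward minimality of `E` give `P(F ∩ E) ≤ P(F)`. That `G` stays in `Ω` is where small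
`h` enters (`IsStepMinimizer.ae_mem_thickening`): far from `E`, deleting a ball saves more
dissipation than it costs perimeter.

Nesting (`IsStepMinimizer.ae_subset`): comparison with `G ∩ E` only shows that `d_E = 0` a.e. on `G
\ E`, so that `G \ E` lies in `∂E`, which might have positive volume. At a density point of `G \ E`
both `G ∩ E` and the complement of `G` are sparse, and both are almost minimal under deletion. De
Giorgi's density estimate (`exists_density_const`) makes both null in a smaller ball, hence also
`E`, which is impossible at a boundary point of a normalized set.

Extinction (`IsStepMinimizer.subset_closedBall`): calibration by the radial field, whose divergence
is `(n-1)/|x|`, shows that an enclosing ball shrinks by a fixed amount in each step. -/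

namespace ATW

/-! ### Calculus of test fields and integration by parts -/

section TestFields

variable {n : ℕ}

theorem sum_single_smul (w : Rn n) : ∑ i : Fin n, w i • EuclideanSpace.single i (1 : ℝ) = w := by
  have := (EuclideanSpace.basisFun (Fin n) ℝ).sum_repr w
  simpa using this

theorem map_eq_sum_single (L : Rn n →L[ℝ] ℝ) (w : Rn n) :
    ∑ i : Fin n, w i * L (EuclideanSpace.single i 1) = L w := by
  conv_rhs => rw [← sum_single_smul w]
  simp

theorem IsTestField.differentiable {ξ : Rn n → Rn n} (h : IsTestField ξ) : Differentiable ℝ ξ :=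
  h.1.differentiable (by norm_num)

theorem IsTestField.zero : IsTestField (fun _ : Rn n => (0 : Rn n)) :=
  ⟨contDiff_const, HasCompactSupport.zero⟩

theorem IsTestField.add {ξ η : Rn n → Rn n} (h : IsTestField ξ) (h' : IsTestField η) :
    IsTestField (fun x => ξ x + η x) :=
  ⟨h.1.add h'.1, h.2.add h'.2⟩

theorem IsTestField.neg {ξ : Rn n → Rn n} (h : IsTestField ξ) : IsTestField (fun x => -ξ x) :=
  ⟨h.1.neg, h.2.neg⟩

theorem IsTestField.smul_left {ξ : Rn n → Rn n} (h : IsTestField ξ) {φ : Rn n → ℝ}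
    (hφ : ContDiff ℝ 1 φ) : IsTestField (fun x => φ x • ξ x) :=
  ⟨hφ.smul h.1, HasCompactSupport.smul_left (f := φ) (f' := ξ) h.2⟩

theorem IsTestField.smul_right {ξ : Rn n → Rn n} (h : ContDiff ℝ 1 ξ) {φ : Rn n → ℝ}
    (hφ : ContDiff ℝ 1 φ) (hs : HasCompactSupport φ) : IsTestField (fun x => φ x • ξ x) :=
  ⟨hφ.smul h, HasCompactSupport.smul_right (f := φ) (f' := ξ) hs⟩

theorem IsTestField.translate {ξ : Rn n → Rn n} (h : IsTestField ξ) (y : Rn n) :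
    IsTestField (fun x => ξ (x + y)) :=
  have h2 : HasCompactSupport (ξ ∘ (Homeomorph.addRight y)) := h.2.comp_homeomorph _
  ⟨h.1.comp (contDiff_id.add contDiff_const), h2⟩

theorem divergence_translate (ξ : Rn n → Rn n) (y x : Rn n) :
    divergence (fun x => ξ (x + y)) x = divergence ξ (x + y) := by
  simp only [divergence, fderiv_comp_add_right]

theorem divergence_add {ξ η : Rn n → Rn n} {x : Rn n} (h : DifferentiableAt ℝ ξ x)
    (h' : DifferentiableAt ℝ η x) :
    divergence (fun x => ξ x + η x) x = divergence ξ x + divergence η x := by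
  simp [divergence, fderiv_fun_add h h', Finset.sum_add_distrib]

theorem divergence_neg (ξ : Rn n → Rn n) (x : Rn n) :
    divergence (fun x => -ξ x) x = -divergence ξ x := by
  simp [divergence, fderiv_fun_neg]

theorem divergence_smul {φ : Rn n → ℝ} {ξ : Rn n → Rn n} {x : Rn n}
    (hφ : DifferentiableAt ℝ φ x) (h : DifferentiableAt ℝ ξ x) :
    divergence (fun x => φ x • ξ x) x = φ x * divergence ξ x + fderiv ℝ φ x (ξ x) := by
  rw [← map_eq_sum_single]
  simp only [divergence, fderiv_fun_smul hφ h, Finset.mul_sum, ← Finset.sum_add_distrib]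
  refine Finset.sum_congr rfl fun i _ => ?_
  simp [mul_comm]

theorem IsTestField.continuous_divergence {ξ : Rn n → Rn n} (h : IsTestField ξ) :
    Continuous (divergence ξ) := by
  unfold divergence
  have := h.1.continuous_fderiv (by norm_num)
  fun_prop

theorem divergence_eq_zero_of_notMem_tsupport {ξ : Rn n → Rn n} {x : Rn n} (hx : x ∉ tsupport ξ) :
    divergence ξ x = 0 := by
  have : fderiv ℝ ξ x = 0 := by
    by_contra h
    exact hx (support_fderiv_subset ℝ h)
  simp [divergence, this]

theorem IsTestField.hasCompactSupport_divergence {ξ : Rn n → Rn n} (h : IsTestField ξ) :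
    HasCompactSupport (divergence ξ) :=
  HasCompactSupport.intro h.2 fun _ hx => divergence_eq_zero_of_notMem_tsupport hx

theorem IsTestField.integrable_divergence {ξ : Rn n → Rn n} (h : IsTestField ξ) :
    Integrable (divergence ξ) :=
  h.continuous_divergence.integrable_of_hasCompactSupport h.hasCompactSupport_divergence

theorem IsTestField.integrable_mul_divergence {ξ : Rn n → Rn n} (h : IsTestField ξ)
    {v : Rn n → ℝ} (hv : LocallyIntegrable v) : Integrable (fun x => v x * divergence ξ x) := by
  have := hv.integrable_smul_left_of_hasCompactSupport h.continuous_divergence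
    h.hasCompactSupport_divergence
  simpa [mul_comm] using this

/-- Integration by parts against a test field. -/
theorem IsTestField.integral_mul_divergence {ξ : Rn n → Rn n} (h : IsTestField ξ)
    {f : Rn n → ℝ} (hf : ContDiff ℝ 1 f) :
    ∫ x, f x * divergence ξ x = -∫ x, fderiv ℝ f x (ξ x) := by
  have hcoord : ∀ i : Fin n, ContDiff ℝ 1 (fun x => ξ x i) := fun i => by
    have := h.1
    fun_prop
  have hsup : ∀ i : Fin n, HasCompactSupport (fun x => ξ x i) := fun i =>
    h.2.comp_left (g := fun w : Rn n => w i) rfl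
  have hfd := hf.continuous_fderiv (by norm_num)
  have hdiv : ∀ i x, (fderiv ℝ ξ x (EuclideanSpace.single i 1)) i =
      fderiv ℝ (fun y => ξ y i) x (EuclideanSpace.single i 1) := fun i x => by
    have h1 : HasFDerivAt (fun y => ξ y i)
        ((EuclideanSpace.proj i : Rn n →L[ℝ] ℝ).comp (fderiv ℝ ξ x)) x :=
      (EuclideanSpace.proj i : Rn n →L[ℝ] ℝ).hasFDerivAt.comp x
        (h.differentiable x).hasFDerivAt
    rw [h1.fderiv]; rfl
  have hI1 : ∀ i : Fin n, Integrable fun x =>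
      f x * fderiv ℝ (fun y => ξ y i) x (EuclideanSpace.single i 1) := fun i => by
    have h1 := (hcoord i).continuous_fderiv (by norm_num)
    refine Continuous.integrable_of_hasCompactSupport
      (hf.continuous.mul (h1.clm_apply continuous_const)) ?_
    exact (((hsup i).fderiv ℝ).comp_left
      (g := fun L : Rn n →L[ℝ] ℝ => L (EuclideanSpace.single i 1)) rfl).mul_left
  have hI2 : ∀ i : Fin n, Integrable fun x =>
      fderiv ℝ f x (EuclideanSpace.single i 1) * ξ x i := fun i => by
    refine Continuous.integrable_of_hasCompactSupport
      ((hfd.clm_apply continuous_const).mul (hcoord i).continuous) (hsup i).mul_left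
  have hI3 : ∀ i : Fin n, Integrable fun x => f x * ξ x i := fun i =>
    Continuous.integrable_of_hasCompactSupport (hf.continuous.mul (hcoord i).continuous)
      (hsup i).mul_left
  have e1 : ∀ x, f x * divergence ξ x =
      ∑ i, f x * fderiv ℝ (fun y => ξ y i) x (EuclideanSpace.single i 1) := fun x => by
    simp only [divergence, Finset.mul_sum, hdiv]
  have e2 : ∀ x, fderiv ℝ f x (ξ x) = ∑ i, fderiv ℝ f x (EuclideanSpace.single i 1) * ξ x i :=
    fun x => by rw [← map_eq_sum_single]; simp [mul_comm]
  simp_rw [e1, e2]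
  rw [integral_finsetSum _ fun i _ => hI1 i, integral_finsetSum _ fun i _ => hI2 i,
    ← Finset.sum_neg_distrib]
  refine Finset.sum_congr rfl fun i _ => ?_
  exact integral_mul_fderiv_eq_neg_fderiv_mul_of_integrable (hI2 i) (hI1 i) (hI3 i)
    (fun x _ => (hf.differentiable (by norm_num)) x)
    (fun x _ => ((hcoord i).differentiable (by norm_num)) x)

theorem IsTestField.integral_divergence {ξ : Rn n → Rn n} (h : IsTestField ξ) :
    ∫ x, divergence ξ x = 0 := by
  simpa using h.integral_mul_divergence (f := fun _ => (1 : ℝ)) contDiff_const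

end TestFields

/-! ### Elementary properties of total variation and perimeter -/

section TotalVariation

variable {n : ℕ}

theorem ofReal_integral_le_totalVariation {ξ : Rn n → Rn n} (h : IsTestField ξ)
    (h1 : ∀ x, ‖ξ x‖ ≤ 1) (v : Rn n → ℝ) :
    ENNReal.ofReal (∫ x, v x * divergence ξ x) ≤ totalVariation v :=
  le_iSup₂_of_le ξ ⟨h, h1⟩ le_rfl

theorem totalVariation_le_iff {v : Rn n → ℝ} {C : ℝ≥0∞} :
    totalVariation v ≤ C ↔ ∀ ξ : Rn n → Rn n, IsTestField ξ → (∀ x, ‖ξ x‖ ≤ 1) →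
      ENNReal.ofReal (∫ x, v x * divergence ξ x) ≤ C := by
  simp only [totalVariation, iSup_le_iff, and_imp]

theorem perimeter_congr {E F : Set (Rn n)} (h : E =ᵐ[volume] F) : perimeter E = perimeter F := by
  unfold perimeter
  simp only [Measure.restrict_congr_set h]

theorem setIntegral_eq_integral_indicator_mul {E : Set (Rn n)} (hE : NullMeasurableSet E)
    (g : Rn n → ℝ) : ∫ x in E, g x = ∫ x, E.indicator (fun _ => (1 : ℝ)) x * g x := by
  rw [← integral_indicator₀ hE]
  congr 1; ext x
  by_cases hx : x ∈ E <;> simp [hx]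

theorem perimeter_eq_totalVariation {E : Set (Rn n)} (hE : NullMeasurableSet E) :
    perimeter E = totalVariation (E.indicator fun _ => (1 : ℝ)) := by
  unfold perimeter totalVariation
  simp only [setIntegral_eq_integral_indicator_mul hE]

theorem ofReal_setIntegral_le_perimeter {ξ : Rn n → Rn n} (h : IsTestField ξ)
    (h1 : ∀ x, ‖ξ x‖ ≤ 1) (E : Set (Rn n)) :
    ENNReal.ofReal (∫ x in E, divergence ξ x) ≤ perimeter E :=
  le_iSup₂_of_le ξ ⟨h, h1⟩ le_rfl

theorem setIntegral_le_perimeter {ξ : Rn n → Rn n} (h : IsTestField ξ)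
    (h1 : ∀ x, ‖ξ x‖ ≤ 1) {E : Set (Rn n)} (hE : perimeter E ≠ ∞) :
    ∫ x in E, divergence ξ x ≤ (perimeter E).toReal :=
  (ENNReal.ofReal_le_iff_le_toReal hE).1 (ofReal_setIntegral_le_perimeter h h1 E)

theorem perimeter_le_iff {E : Set (Rn n)} {C : ℝ≥0∞} :
    perimeter E ≤ C ↔ ∀ ξ : Rn n → Rn n, IsTestField ξ → (∀ x, ‖ξ x‖ ≤ 1) →
      ENNReal.ofReal (∫ x in E, divergence ξ x) ≤ C := by
  simp only [perimeter, iSup_le_iff, and_imp]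

/-- Since `∫ div ξ = 0`, pairing the complement with `ξ` is pairing `E` with `-ξ`. -/
theorem perimeter_compl_le {E : Set (Rn n)} (hE : NullMeasurableSet E) :
    perimeter Eᶜ ≤ perimeter E := by
  rw [perimeter_le_iff]
  intro ξ hξ h1
  have h2 := integral_add_compl₀ hE hξ.integrable_divergence
  rw [hξ.integral_divergence] at h2
  have h3 := ofReal_setIntegral_le_perimeter hξ.neg (by simpa using h1) E
  simp only [divergence_neg, integral_neg] at h3
  rwa [show ∫ x in Eᶜ, divergence ξ x = -∫ x in E, divergence ξ x by linarith]

theorem perimeter_compl {E : Set (Rn n)} (hE : NullMeasurableSet E) :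
    perimeter Eᶜ = perimeter E :=
  le_antisymm (perimeter_compl_le hE) (by simpa using perimeter_compl_le hE.compl)

theorem totalVariation_add_le {v w : Rn n → ℝ} (hv : LocallyIntegrable v)
    (hw : LocallyIntegrable w) :
    totalVariation (fun x => v x + w x) ≤ totalVariation v + totalVariation w := by
  rw [totalVariation_le_iff]
  intro ξ hξ h1
  simp only [add_mul]
  rw [integral_add (hξ.integrable_mul_divergence hv) (hξ.integrable_mul_divergence hw)]
  exact ENNReal.ofReal_add_le.trans (add_le_add (ofReal_integral_le_totalVariation hξ h1 v)
    (ofReal_integral_le_totalVariation hξ h1 w))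

theorem totalVariation_zero : totalVariation (fun _ : Rn n => (0 : ℝ)) = 0 := by
  simp [totalVariation]

theorem totalVariation_const_mul_le {c : ℝ} (hc : 0 ≤ c) (v : Rn n → ℝ) :
    totalVariation (fun x => c * v x) ≤ ENNReal.ofReal c * totalVariation v := by
  rw [totalVariation_le_iff]
  intro ξ hξ h1
  simp only [mul_assoc]
  rw [integral_const_mul, ENNReal.ofReal_mul hc]
  gcongr
  exact ofReal_integral_le_totalVariation hξ h1 v

theorem totalVariation_sum_le {ι : Type*} (s : Finset ι) {v : ι → Rn n → ℝ}
    (hv : ∀ i ∈ s, LocallyIntegrable (v i)) :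
    totalVariation (fun x => ∑ i ∈ s, v i x) ≤ ∑ i ∈ s, totalVariation (v i) := by
  classical
  induction s using Finset.induction_on with
  | empty => simp [totalVariation_zero]
  | insert a s ha ih =>
    simp only [Finset.sum_insert ha]
    have h2 : ∀ i ∈ s, LocallyIntegrable (v i) := fun i hi => hv i (Finset.mem_insert_of_mem hi)
    refine (totalVariation_add_le (hv a (Finset.mem_insert_self a s)) ?_).trans
      (add_le_add le_rfl (ih h2))
    exact locallyIntegrable_finsetSum s h2

theorem locallyIntegrable_indicator_one {E : Set (Rn n)} (hE : NullMeasurableSet E) :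
    LocallyIntegrable (E.indicator fun _ => (1 : ℝ)) := by
  have h1 : LocallyIntegrable (fun _ : Rn n => (1 : ℝ)) := locallyIntegrable_const 1
  refine h1.mono ((aestronglyMeasurable_const).indicator₀ hE) (ae_of_all _ fun x => ?_)
  by_cases hx : x ∈ E <;> simp [hx]

/-- Lower semicontinuity of the perimeter. -/
theorem perimeter_le_liminf {E : Set (Rn n)} {F : ℕ → Set (Rn n)}
    (h : ∀ ξ : Rn n → Rn n, IsTestField ξ →
      Tendsto (fun j => ∫ x in F j, divergence ξ x) atTop (𝓝 (∫ x in E, divergence ξ x))) :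
    perimeter E ≤ liminf (fun j => perimeter (F j)) atTop := by
  rw [perimeter_le_iff]
  intro ξ hξ h1
  have := (ENNReal.continuous_ofReal.tendsto _).comp (h ξ hξ)
  rw [← this.liminf_eq]
  exact liminf_le_liminf (Eventually.of_forall fun j => ofReal_setIntegral_le_perimeter hξ h1 _)

end TotalVariation

/-! ### Total variation of smooth functions -/

section Smooth

variable {n : ℕ}

/-- The Euclidean gradient. -/
noncomputable def grad (f : Rn n → ℝ) (x : Rn n) : Rn n :=
  WithLp.toLp 2 fun i => fderiv ℝ f x (EuclideanSpace.single i 1)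

theorem inner_grad (f : Rn n → ℝ) (x w : Rn n) : inner ℝ (grad f x) w = fderiv ℝ f x w := by
  rw [← map_eq_sum_single, PiLp.inner_apply]
  simp [grad]

theorem norm_grad (f : Rn n → ℝ) (x : Rn n) : ‖grad f x‖ = ‖fderiv ℝ f x‖ := by
  apply le_antisymm
  · rcases eq_or_ne (grad f x) 0 with h | h
    · simp [h]
    · have h1 : fderiv ℝ f x (grad f x) = ‖grad f x‖ * ‖grad f x‖ := by
        rw [← inner_grad, real_inner_self_eq_norm_mul_norm]
      have h2 := (fderiv ℝ f x).le_opNorm (grad f x)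
      rw [h1, Real.norm_of_nonneg (by positivity)] at h2
      exact le_of_mul_le_mul_right h2 (norm_pos_iff.2 h)
  · refine ContinuousLinearMap.opNorm_le_bound _ (norm_nonneg _) fun w => ?_
    rw [← inner_grad]
    exact norm_inner_le_norm _ _

theorem contDiff_grad {f : Rn n → ℝ} (hf : ContDiff ℝ 2 f) : ContDiff ℝ 1 (grad f) := by
  rw [contDiff_euclidean]
  intro i
  have h1 : ContDiff ℝ 1 (fderiv ℝ f) := hf.fderiv_right (by norm_num)
  exact h1.clm_apply contDiff_const

theorem tendsto_sq_div_sqrt {a : ℝ} (ha : 0 ≤ a) :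
    Tendsto (fun k : ℕ => a ^ 2 / √(a ^ 2 + (1 / ((k : ℝ) + 1)) ^ 2)) atTop (𝓝 a) := by
  rcases ha.eq_or_lt with h | h
  · simp [← h]
  have h1 : Tendsto (fun k : ℕ => √(a ^ 2 + (1 / ((k : ℝ) + 1)) ^ 2)) atTop (𝓝 a) := by
    have h2 := (((tendsto_one_div_add_atTop_nhds_zero_nat (𝕜 := ℝ)).pow 2).const_add (a ^ 2)).sqrt
    simpa [Real.sqrt_sq ha] using h2
  have h3 := (tendsto_const_nhds (x := a ^ 2)).div h1 h.ne'
  rwa [show a ^ 2 / a = a by field_simp] at h3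

/-- For `f` of class `C²`, the `L¹` norm of the derivative is at most the total variation. -/
theorem lintegral_enorm_fderiv_le {f : Rn n → ℝ} (hf : ContDiff ℝ 2 f) :
    ∫⁻ x, ‖fderiv ℝ f x‖ₑ ≤ totalVariation f := by
  have hg := contDiff_grad hf
  let χ : ℕ → ContDiffBump (0 : Rn n) := fun k => ⟨k + 1, k + 2, by positivity, by linarith⟩
  let q : ℕ → Rn n → ℝ := fun k x => √(‖grad f x‖ ^ 2 + (1 / ((k : ℝ) + 1)) ^ 2)
  have hq : ∀ k x, 0 < q k x := fun k x => Real.sqrt_pos.2 (by positivity)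
  have hqs : ∀ k, ContDiff ℝ 1 (q k) := fun k =>
    ContDiff.sqrt ((hg.norm_sq ℝ).add contDiff_const) fun x =>
      (by positivity : (0 : ℝ) < ‖grad f x‖ ^ 2 + (1 / ((k : ℝ) + 1)) ^ 2).ne'
  have hgq : ∀ k x, ‖grad f x‖ ≤ q k x := fun k x =>
    Real.le_sqrt_of_sq_le (le_add_of_nonneg_right (by positivity))
  -- A cut-off, regularized version of `-∇f/|∇f|`, which nearly attains the supremum; the `1/(k+1)`
  -- in `q k` keeps it `C¹` where the gradient vanishes.
  let ξ : ℕ → Rn n → Rn n := fun k x => (-(χ k x * (q k x)⁻¹)) • grad f x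
  have hξ : ∀ k, IsTestField (ξ k) := fun k =>
    IsTestField.smul_right hg (((χ k).contDiff.mul ((hqs k).inv fun x => (hq k x).ne')).neg)
      ((χ k).hasCompactSupport.mul_right.neg)
  have hξ1 : ∀ k x, ‖ξ k x‖ ≤ 1 := fun k x => by
    simp only [ξ, norm_smul, norm_neg, norm_mul, norm_inv, Real.norm_of_nonneg (χ k).nonneg,
      Real.norm_of_nonneg (hq k x).le, mul_assoc]
    have h1 : (q k x)⁻¹ * ‖grad f x‖ ≤ 1 := by
      rw [inv_mul_le_iff₀ (hq k x)]; simpa using hgq k x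
    exact mul_le_one₀ (χ k).le_one
      (mul_nonneg (inv_nonneg.2 (hq k x).le) (norm_nonneg _)) h1
  let F : ℕ → Rn n → ℝ := fun k x => χ k x * (‖grad f x‖ ^ 2 / q k x)
  have hF : ∀ k x, -fderiv ℝ f x (ξ k x) = F k x := fun k x => by
    rw [← inner_grad]
    simp only [ξ, F, inner_smul_right, real_inner_self_eq_norm_sq]
    field_simp
  have hFc : ∀ k, Continuous (F k) := fun k =>
    (χ k).continuous.mul (((hg.continuous.norm).pow 2).div (hqs k).continuous
      fun x => (hq k x).ne')
  have hF0 : ∀ k x, 0 ≤ F k x := fun k x => mul_nonneg (χ k).nonneg (by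
    have := hq k x; positivity)
  have hle : ∀ k, ∫⁻ x, ENNReal.ofReal (F k x) ≤ totalVariation f := fun k => by
    have h1 := ofReal_integral_le_totalVariation (hξ k) (hξ1 k) f
    rw [(hξ k).integral_mul_divergence (hf.of_le (by norm_num)), ← integral_neg] at h1
    simp_rw [hF] at h1
    rwa [ofReal_integral_eq_lintegral_ofReal ((hFc k).integrable_of_hasCompactSupport
      (χ k).hasCompactSupport.mul_right) (ae_of_all _ (hF0 k))] at h1
  have hlim : ∀ x, Tendsto (fun k => ENNReal.ofReal (F k x)) atTop (𝓝 ‖fderiv ℝ f x‖ₑ) := fun x => by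
    rw [← ofReal_norm, ← norm_grad]
    refine (ENNReal.continuous_ofReal.tendsto _).comp ?_
    refine (tendsto_sq_div_sqrt (norm_nonneg (grad f x))).congr' ?_
    obtain ⟨N, hN⟩ := exists_nat_ge ‖x‖
    filter_upwards [eventually_ge_atTop N] with k hk
    have : χ k x = 1 := (χ k).one_of_mem_closedBall (by
      simp only [χ, mem_closedBall_zero_iff]
      have : (N : ℝ) ≤ k := by exact_mod_cast hk
      linarith)
    simp [F, this, q]
  calc ∫⁻ x, ‖fderiv ℝ f x‖ₑ = ∫⁻ x, liminf (fun k => ENNReal.ofReal (F k x)) atTop := by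
        simp_rw [fun x => (hlim x).liminf_eq]
    _ ≤ liminf (fun k => ∫⁻ x, ENNReal.ofReal (F k x)) atTop :=
        lintegral_liminf_le fun k => (hFc k).measurable.ennreal_ofReal
    _ ≤ totalVariation f := by
        refine liminf_le_of_le (by isBoundedDefault) fun b hb => ?_
        obtain ⟨k, hk⟩ := hb.exists
        exact hk.trans (hle k)

/-- For `f` of class `C¹`, the total variation is at most the `L¹` norm of the derivative. -/
theorem totalVariation_le_lintegral_enorm_fderiv {f : Rn n → ℝ} (hf : ContDiff ℝ 1 f) :
    totalVariation f ≤ ∫⁻ x, ‖fderiv ℝ f x‖ₑ := by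
  rw [totalVariation_le_iff]
  intro ξ hξ h1
  rw [hξ.integral_mul_divergence hf, ← integral_neg]
  refine (ENNReal.ofReal_le_ofReal (le_abs_self _)).trans ?_
  rw [← Real.norm_eq_abs, ofReal_norm]
  refine (enorm_integral_le_lintegral_enorm _).trans (lintegral_mono fun x => ?_)
  rw [enorm_neg, ← ofReal_norm, ← ofReal_norm]
  refine ENNReal.ofReal_le_ofReal ?_
  calc ‖fderiv ℝ f x (ξ x)‖ ≤ ‖fderiv ℝ f x‖ * ‖ξ x‖ := ContinuousLinearMap.le_opNorm _ _
    _ ≤ ‖fderiv ℝ f x‖ * 1 := by gcongr; exact h1 x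
    _ = _ := mul_one _

end Smooth

/-! ### Mollification does not increase the variation -/

section Mollification

variable {n : ℕ}

/-- Convolution with a normalized smooth bump. -/
noncomputable def mollify (φ : ContDiffBump (0 : Rn n)) (v : Rn n → ℝ) : Rn n → ℝ :=
  convolution (φ.normed volume) v (ContinuousLinearMap.lsmul ℝ ℝ) volume

theorem mollify_apply (φ : ContDiffBump (0 : Rn n)) (v : Rn n → ℝ) (x : Rn n) :
    mollify φ v x = ∫ t, φ.normed volume t * v (x - t) := rfl

theorem contDiff_mollify (φ : ContDiffBump (0 : Rn n)) {v : Rn n → ℝ} (hv : LocallyIntegrable v)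
    (m : ℕ∞) : ContDiff ℝ m (mollify φ v) :=
  φ.hasCompactSupport_normed.contDiff_convolution_left _ φ.contDiff_normed hv

theorem integrable_mollify_integrand (φ : ContDiffBump (0 : Rn n)) {v : Rn n → ℝ}
    (hv : LocallyIntegrable v) {D : Rn n → ℝ} (hD : Continuous D) (hDs : HasCompactSupport D) :
    Integrable (fun p : Rn n × Rn n => φ.normed volume p.2 * v (p.1 - p.2) * D p.1)
      (volume.prod volume) := by
  obtain ⟨R, hR⟩ := hDs.isBounded.subset_closedBall (0 : Rn n)
  -- Only values of `v` within `rOut` of the support of `D` matter; truncating `v` makes it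
  -- integrable without changing the integrand.
  let w : Rn n → ℝ := (Metric.closedBall (0 : Rn n) (R + φ.rOut)).indicator v
  have hw : Integrable w := (hv.integrableOn_isCompact (isCompact_closedBall _ _)).integrable_indicator
    Metric.isClosed_closedBall.measurableSet
  have h1 : Integrable (fun p : Rn n × Rn n => φ.normed volume p.2 * w (p.1 - p.2))
      (volume.prod volume) :=
    Integrable.convolution_integrand (ContinuousLinearMap.lsmul ℝ ℝ) φ.integrable_normed hw
  obtain ⟨C, hC⟩ := hD.bounded_above_of_compact_support hDs
  have h2 := h1.mul_bdd (g := fun p : Rn n × Rn n => D p.1) (c := C)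
    (hD.comp continuous_fst).aestronglyMeasurable (ae_of_all _ fun p => hC p.1)
  refine h2.congr (ae_of_all _ fun p => ?_)
  simp only
  by_cases hp : p.1 ∈ tsupport D
  · by_cases hq : p.2 ∈ Function.support (φ.normed volume)
    · rw [φ.support_normed_eq] at hq
      have h3 : p.1 - p.2 ∈ Metric.closedBall (0 : Rn n) (R + φ.rOut) := by
        have h4 := hR hp
        rw [mem_closedBall_zero_iff] at h4 ⊢
        rw [mem_ball_zero_iff] at hq
        exact (norm_sub_le _ _).trans (by linarith)
      simp [w, h3]
    · simp [Function.notMem_support.1 hq]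
  · simp [image_eq_zero_of_notMem_tsupport hp]

/-- Fubini turns the pairing of the mollification with `ξ` into an average, weighted by the bump, of
pairings of `v` with translates of `ξ`, and translates are again admissible. -/
theorem totalVariation_mollify_le (φ : ContDiffBump (0 : Rn n)) {v : Rn n → ℝ}
    (hv : LocallyIntegrable v) : totalVariation (mollify φ v) ≤ totalVariation v := by
  rcases eq_or_ne (totalVariation v) ∞ with htop | htop
  · simp [htop]
  rw [totalVariation_le_iff]
  intro ξ hξ h1
  rw [ENNReal.ofReal_le_iff_le_toReal htop]
  have hI := integrable_mollify_integrand φ hv hξ.continuous_divergence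
    hξ.hasCompactSupport_divergence
  have e1 : ∫ x, mollify φ v x * divergence ξ x =
      ∫ t, ∫ x, φ.normed volume t * v (x - t) * divergence ξ x := by
    rw [← integral_integral_swap hI]
    simp_rw [mollify_apply, integral_mul_const]
  rw [e1]
  have e2 : ∀ t, ∫ x, φ.normed volume t * v (x - t) * divergence ξ x =
      φ.normed volume t * ∫ x, v x * divergence (fun x => ξ (x + t)) x := fun t => by
    simp_rw [mul_assoc, integral_const_mul, divergence_translate]
    rw [← integral_sub_right_eq_self (fun x => v x * divergence ξ (x + t)) t]
    simp
  have hle : ∀ t, ∫ x, φ.normed volume t * v (x - t) * divergence ξ x ≤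
      φ.normed volume t * (totalVariation v).toReal := fun t => by
    rw [e2]
    gcongr
    · exact φ.nonneg_normed t
    · exact (ENNReal.ofReal_le_iff_le_toReal htop).1
        (ofReal_integral_le_totalVariation (hξ.translate t) (fun x => h1 _) v)
  calc _ ≤ ∫ t, φ.normed volume t * (totalVariation v).toReal :=
        integral_mono hI.integral_prod_right (φ.integrable_normed.mul_const _) hle
    _ = _ := by rw [integral_mul_const, φ.integral_normed, one_mul]

/-- A standard sequence of bumps shrinking to the origin. -/
noncomputable def stdBump (n : ℕ) (j : ℕ) : ContDiffBump (0 : Rn n) :=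
  ⟨1 / (j + 1), 2 / (j + 1), by positivity, by gcongr; norm_num⟩

theorem ae_tendsto_mollify {v : Rn n → ℝ} (hv : LocallyIntegrable v) :
    ∀ᵐ x, Tendsto (fun j => mollify (stdBump n j) v x) atTop (𝓝 (v x)) := by
  refine ContDiffBump.ae_convolution_tendsto_right_of_locallyIntegrable (K := 2) ?_ ?_ hv
  · have := (tendsto_one_div_add_atTop_nhds_zero_nat (𝕜 := ℝ)).const_mul 2
    simpa [stdBump, div_eq_mul_inv] using this
  · refine Eventually.of_forall fun j => le_of_eq ?_
    simp only [stdBump]; ring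

end Mollification

/-! ### Smoothed indicators of superlevel sets -/

section Step

/-- A smooth step from `0` (for `y ≤ t`) to `1` (for `y ≥ t + 1 / c`). -/
noncomputable def smoothStep (c t y : ℝ) : ℝ := Real.smoothTransition (c * (y - t))

/-- The derivative of `Real.smoothTransition`. -/
noncomputable def stepDeriv (y : ℝ) : ℝ := deriv Real.smoothTransition y

theorem stepDeriv_nonneg (y : ℝ) : 0 ≤ stepDeriv y := Real.smoothTransition.monotone.deriv_nonneg

theorem continuous_stepDeriv : Continuous stepDeriv :=
  (Real.smoothTransition.contDiff (n := 1)).continuous_deriv (by norm_num)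

theorem hasDerivAt_smoothTransition (y : ℝ) :
    HasDerivAt Real.smoothTransition (stepDeriv y) y :=
  ((Real.smoothTransition.contDiff (n := 1)).differentiable (by norm_num) y).hasDerivAt

theorem stepDeriv_eq_zero {y : ℝ} (hy : y ≤ 0 ∨ 1 ≤ y) : stepDeriv y = 0 := by
  have h0 : IsClosed {y | stepDeriv y = 0} := isClosed_eq continuous_stepDeriv continuous_const
  rcases hy with h | h
  · have h1 : Iio (0 : ℝ) ⊆ {y | stepDeriv y = 0} := fun z hz => by
      have : Real.smoothTransition =ᶠ[𝓝 z] fun _ => 0 := by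
        filter_upwards [Iio_mem_nhds hz] with w hw
        exact Real.smoothTransition.zero_of_nonpos (le_of_lt hw)
      simp [stepDeriv, this.deriv_eq]
    have h2 := closure_minimal h1 h0
    rw [closure_Iio] at h2
    exact h2 h
  · have h1 : Ioi (1 : ℝ) ⊆ {y | stepDeriv y = 0} := fun z hz => by
      have : Real.smoothTransition =ᶠ[𝓝 z] fun _ => 1 := by
        filter_upwards [Ioi_mem_nhds hz] with w hw
        exact Real.smoothTransition.one_of_one_le (le_of_lt hw)
      simp [stepDeriv, this.deriv_eq]
    have h2 := closure_minimal h1 h0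
    rw [closure_Ioi] at h2
    exact h2 h

theorem integrable_stepDeriv : Integrable stepDeriv := by
  refine continuous_stepDeriv.integrable_of_hasCompactSupport
    (HasCompactSupport.intro (isCompact_Icc (a := (0 : ℝ)) (b := 1)) fun y hy => ?_)
  rw [mem_Icc, not_and_or, not_le, not_le] at hy
  exact stepDeriv_eq_zero (hy.imp le_of_lt le_of_lt)

/-- The integrand is the `t`-derivative of `-smoothTransition (c (a - t))`, which runs from `-1` to
`0`. The coarea argument uses this to integrate out the level. -/
theorem lintegral_stepDeriv {c : ℝ} (hc : 0 < c) (a : ℝ) :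
    ∫⁻ t, ENNReal.ofReal (c * stepDeriv (c * (a - t))) = 1 := by
  have hI : Integrable fun t => c * stepDeriv (c * (a - t)) :=
    ((integrable_stepDeriv.comp_mul_left' hc.ne').comp_sub_left a).const_mul c
  rw [← ofReal_integral_eq_lintegral_ofReal hI
    (ae_of_all _ fun t => mul_nonneg hc.le (stepDeriv_nonneg _))]
  have h1 : ∀ t, HasDerivAt (fun t => -Real.smoothTransition (c * (a - t)))
      (c * stepDeriv (c * (a - t))) t := fun t => by
    have h2 : HasDerivAt (fun t => c * (a - t)) (c * -1) t :=
      ((hasDerivAt_id t).const_sub a).const_mul c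
    have h3 : HasDerivAt (fun t => -Real.smoothTransition (c * (a - t)))
        (-(stepDeriv (c * (a - t)) * (c * -1))) t :=
      (HasDerivAt.comp (h₂ := Real.smoothTransition) t
        (hasDerivAt_smoothTransition (c * (a - t))) h2).fun_neg
    exact h3.congr_deriv (by ring)
  have hbot : Tendsto (fun t => -Real.smoothTransition (c * (a - t))) atBot (𝓝 (-1)) := by
    refine tendsto_const_nhds.congr' ?_
    filter_upwards [eventually_le_atBot (a - 1 / c)] with t ht
    rw [Real.smoothTransition.one_of_one_le]
    calc 1 = c * (1 / c) := by field_simp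
      _ ≤ _ := by gcongr; linarith
  have htop : Tendsto (fun t => -Real.smoothTransition (c * (a - t))) atTop (𝓝 0) := by
    refine tendsto_const_nhds.congr' ?_
    filter_upwards [eventually_ge_atTop a] with t ht
    rw [Real.smoothTransition.zero_of_nonpos, neg_zero]
    exact mul_nonpos_of_nonneg_of_nonpos hc.le (by linarith)
  rw [integral_of_hasDerivAt_of_tendsto h1 hI hbot htop]
  simp

theorem smoothStep_nonneg (c t y : ℝ) : 0 ≤ smoothStep c t y := Real.smoothTransition.nonneg _

theorem smoothStep_le_one (c t y : ℝ) : smoothStep c t y ≤ 1 := Real.smoothTransition.le_one _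

/-- The step rises within `ε/(k+1)` to the right of `t` and vanishes at `t` itself, so the limit is
the indicator of the strict superlevel set. -/
theorem smoothStep_eventually {ε : ℝ} (hε : 0 < ε) (t y : ℝ) :
    ∀ᶠ k : ℕ in atTop, smoothStep ((k + 1) / ε) t y = if t < y then 1 else 0 := by
  split_ifs with h
  · obtain ⟨N, hN⟩ := exists_nat_ge (ε / (y - t))
    filter_upwards [eventually_ge_atTop N] with k hk
    refine Real.smoothTransition.one_of_one_le ?_
    have h1 : (N : ℝ) ≤ k := by exact_mod_cast hk
    have h2 : 0 < y - t := sub_pos.2 h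
    rw [div_mul_eq_mul_div, le_div_iff₀ hε, one_mul, ← div_le_iff₀ h2]
    linarith
  · refine Eventually.of_forall fun k => Real.smoothTransition.zero_of_nonpos ?_
    exact mul_nonpos_of_nonneg_of_nonpos (by positivity) (by linarith)

variable {n : ℕ}

theorem contDiff_smoothStep_comp {m : ℕ∞} {f : Rn n → ℝ} (hf : ContDiff ℝ m f) (c t : ℝ) :
    ContDiff ℝ m fun x => smoothStep c t (f x) :=
  Real.smoothTransition.contDiff.comp (contDiff_const.mul (hf.sub contDiff_const))

theorem fderiv_smoothStep_comp {f : Rn n → ℝ} {x : Rn n} (hf : DifferentiableAt ℝ f x)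
    (c t : ℝ) : fderiv ℝ (fun x => smoothStep c t (f x)) x =
      (c * stepDeriv (c * (f x - t))) • fderiv ℝ f x := by
  have h1 : HasFDerivAt (fun x => c * (f x - t)) (c • fderiv ℝ f x) x :=
    (hf.hasFDerivAt.sub_const t).const_mul c
  have h2 := (hasDerivAt_smoothTransition (c * (f x - t))).comp_hasFDerivAt x h1
  have h3 : HasFDerivAt (fun x => smoothStep c t (f x))
      (stepDeriv (c * (f x - t)) • c • fderiv ℝ f x) x := h2
  rw [h3.fderiv, smul_smul, mul_comm]

/-- Dominated convergence for the smoothed characteristic functions of superlevel sets. -/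
theorem tendsto_integral_smoothStep {ε : ℝ} (hε : 0 < ε) {f : Rn n → ℝ} (hf : Continuous f)
    {E : Set (Rn n)} {g : Rn n → ℝ} (hg : Integrable g (volume.restrict E)) (t : ℝ) :
    Tendsto (fun k : ℕ => ∫ x in E, smoothStep ((k + 1) / ε) t (f x) * g x) atTop
      (𝓝 (∫ x in E ∩ {x | t < f x}, g x)) := by
  have hm : MeasurableSet {x | t < f x} := (isOpen_lt continuous_const hf).measurableSet
  rw [inter_comm, ← Measure.restrict_restrict hm, ← integral_indicator hm]
  refine tendsto_integral_of_dominated_convergence (fun x => ‖g x‖) (fun k => ?_) hg.norm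
    (fun k => ae_of_all _ fun x => ?_) (ae_of_all _ fun x => ?_)
  · refine AEStronglyMeasurable.mul (Continuous.aestronglyMeasurable ?_) hg.1
    exact Real.smoothTransition.continuous.comp (by fun_prop)
  · rw [norm_mul, Real.norm_of_nonneg (smoothStep_nonneg _ _ _)]
    exact mul_le_of_le_one_left (norm_nonneg _) (smoothStep_le_one _ _ _)
  · refine tendsto_const_nhds.congr' ?_
    filter_upwards [smoothStep_eventually hε t (f x)] with k hk
    rw [hk]
    by_cases h : t < f x <;> simp [h]

end Step

/-! ### Coarea inequality and submodularity of the perimeter -/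

section Coarea

variable {n : ℕ}

/-- The coarea inequality for `C¹` functions, with a measurable majorant of the perimeters. -/
theorem exists_perimeter_majorant {f : Rn n → ℝ} (hf : ContDiff ℝ 1 f) :
    ∃ G : ℝ → ℝ≥0∞, Measurable G ∧ (∀ t, perimeter {x | t < f x} ≤ G t) ∧
      ∫⁻ t, G t ≤ ∫⁻ x, ‖fderiv ℝ f x‖ₑ := by
  have hfd : Continuous (fderiv ℝ f) := hf.continuous_fderiv (by norm_num)
  let c : ℕ → ℝ := fun k => (k + 1) / 1
  have hc : ∀ k, 0 < c k := fun k => by simp only [c]; positivity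
  -- `H k t x` is the norm of the `x`-derivative of the smoothed indicator of `{f > t}`. Integrating
  -- first in `t` leaves `‖fderiv ℝ f x‖`, so Tonelli and then Fatou give the bound.
  let H : ℕ → ℝ → Rn n → ℝ≥0∞ := fun k t x =>
    ENNReal.ofReal (c k * stepDeriv (c k * (f x - t))) * ‖fderiv ℝ f x‖ₑ
  have hHm : ∀ k, Measurable (Function.uncurry (H k)) := fun k => by
    refine Measurable.mul (Measurable.ennreal_ofReal (Continuous.measurable ?_))
      (hfd.comp continuous_snd).measurable.enorm
    exact continuous_const.mul (continuous_stepDeriv.comp (continuous_const.mul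
      ((hf.continuous.comp continuous_snd).sub continuous_fst)))
  have hGm : ∀ k, Measurable fun t => ∫⁻ x, H k t x := fun k => (hHm k).lintegral_prod_right'
  have hGi : ∀ k, ∫⁻ t, ∫⁻ x, H k t x = ∫⁻ x, ‖fderiv ℝ f x‖ₑ := fun k => by
    rw [lintegral_lintegral_swap (hHm k).aemeasurable]
    refine lintegral_congr fun x => ?_
    simp only [H]
    rw [lintegral_mul_const, lintegral_stepDeriv (hc k), one_mul]
    refine Measurable.ennreal_ofReal (Continuous.measurable ?_)
    exact continuous_const.mul (continuous_stepDeriv.comp (by fun_prop))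
  -- The liminf is measurable in `t` by construction, whereas measurability of the perimeter as a
  -- function of the level is never established.
  refine ⟨fun t => liminf (fun k => ∫⁻ x, H k t x) atTop, Measurable.liminf hGm, fun t => ?_, ?_⟩
  · rw [perimeter_le_iff]
    intro ξ hξ h1
    have hlim := tendsto_integral_smoothStep one_pos hf.continuous (E := univ)
      hξ.integrable_divergence.integrableOn t
    simp only [univ_inter, Measure.restrict_univ] at hlim
    rw [← ((ENNReal.continuous_ofReal.tendsto _).comp hlim).liminf_eq]
    refine liminf_le_liminf (Eventually.of_forall fun k => ?_)
    have e1 := hξ.integral_mul_divergence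
      (contDiff_smoothStep_comp (m := 1) (by exact_mod_cast hf) (c k) t)
    simp only [Function.comp]
    change ENNReal.ofReal (∫ x, smoothStep (c k) t (f x) * divergence ξ x) ≤ _
    rw [e1, ← integral_neg]
    refine (ENNReal.ofReal_le_ofReal (le_abs_self _)).trans ?_
    rw [← Real.norm_eq_abs, ofReal_norm]
    refine (enorm_integral_le_lintegral_enorm _).trans (lintegral_mono fun x => ?_)
    rw [fderiv_smoothStep_comp (hf.differentiable (by norm_num) x), enorm_neg]
    simp only [H]
    rw [smul_apply, smul_eq_mul, enorm_mul]
    refine mul_le_mul' (le_of_eq (Real.enorm_of_nonneg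
      (mul_nonneg (hc k).le (stepDeriv_nonneg _)))) ?_
    rw [← ofReal_norm, ← ofReal_norm]
    refine ENNReal.ofReal_le_ofReal ?_
    calc ‖fderiv ℝ f x (ξ x)‖ ≤ ‖fderiv ℝ f x‖ * ‖ξ x‖ := ContinuousLinearMap.le_opNorm _ _
      _ ≤ ‖fderiv ℝ f x‖ * 1 := by gcongr; exact h1 x
      _ = _ := mul_one _
  · refine (lintegral_liminf_le hGm).trans ?_
    simp_rw [hGi]
    simp

/-- Dominated convergence with majorant `|div ξ|` reduces this to convergence of the pairings. -/
theorem perimeter_le_liminf_of_ae {E : Set (Rn n)} {F : ℕ → Set (Rn n)} (hE : NullMeasurableSet E)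
    (hF : ∀ j, NullMeasurableSet (F j)) (h : ∀ᵐ x, ∀ᶠ j in atTop, (x ∈ F j ↔ x ∈ E)) :
    perimeter E ≤ liminf (fun j => perimeter (F j)) atTop := by
  refine perimeter_le_liminf fun ξ hξ => ?_
  have hI := hξ.integrable_divergence
  simp_rw [fun j => setIntegral_eq_integral_indicator_mul (hF j) (divergence ξ),
    setIntegral_eq_integral_indicator_mul hE (divergence ξ)]
  refine tendsto_integral_of_dominated_convergence (fun x => ‖divergence ξ x‖)
    (fun j => (aestronglyMeasurable_const.indicator₀ (hF j)).mul hI.1) hI.norm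
    (fun j => ae_of_all _ fun x => ?_) ?_
  · by_cases hx : x ∈ F j <;> simp [hx]
  · filter_upwards [h] with x hx
    refine tendsto_const_nhds.congr' ?_
    filter_upwards [hx] with j hj
    by_cases hxE : x ∈ E
    · simp [hxE, hj.2 hxE]
    · simp [hxE, mt hj.1 hxE]

theorem nullMeasurableSet_superlevel {v : Rn n → ℝ} (hv : LocallyIntegrable v) (t : ℝ) :
    NullMeasurableSet {x | t < v x} :=
  nullMeasurableSet_lt aemeasurable_const hv.aestronglyMeasurable.aemeasurable

/-- The coarea inequality, with a measurable majorant of the perimeters. -/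
theorem exists_ae_perimeter_majorant {v : Rn n → ℝ} (hv : LocallyIntegrable v) :
    ∃ G : ℝ → ℝ≥0∞, Measurable G ∧ (∀ᵐ t, perimeter {x | t < v x} ≤ G t) ∧
      ∫⁻ t, G t ≤ totalVariation v := by
  have hs : ∀ j, ContDiff ℝ 2 (mollify (stdBump n j) v) := fun j =>
    contDiff_mollify (stdBump n j) hv 2
  choose G hGm hGp hGi using fun j => exists_perimeter_majorant ((hs j).of_le (by norm_num))
  have hGi' : ∀ j, ∫⁻ t, G j t ≤ totalVariation v := fun j =>
    (hGi j).trans ((lintegral_enorm_fderiv_le (hs j)).trans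
      (totalVariation_mollify_le (stdBump n j) hv))
  -- Only countably many level sets have positive volume. For every other level, a.e. convergence of
  -- the mollifications makes the superlevel sets converge a.e.
  have hlev : ∀ᵐ t : ℝ, volume {x | v x = t} = 0 := by
    have h1 := (Measure.countable_meas_level_set_pos₀ (μ := (volume : Measure (Rn n)))
      hv.aestronglyMeasurable.aemeasurable.nullMeasurable).ae_notMem (volume : Measure ℝ)
    filter_upwards [h1] with t ht
    simpa using ht
  have hle : ∀ᵐ t : ℝ, perimeter {x | t < v x} ≤ liminf (fun j => G j t) atTop := by
    filter_upwards [hlev] with t ht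
    refine (perimeter_le_liminf_of_ae (nullMeasurableSet_superlevel hv t)
      (F := fun j => {x | t < mollify (stdBump n j) v x})
      (fun j => (isOpen_lt continuous_const (hs j).continuous).measurableSet.nullMeasurableSet)
      ?_).trans (liminf_le_liminf (Eventually.of_forall fun j => hGp j t))
    have h2 : ∀ᵐ x, v x ≠ t := by
      rw [ae_iff]; simpa using ht
    filter_upwards [h2, ae_tendsto_mollify hv] with x hx hlim
    rcases lt_or_gt_of_ne hx with h | h
    · filter_upwards [hlim.eventually (Iio_mem_nhds h)] with j hj
      exact iff_of_false (not_lt.2 (le_of_lt hj)) (not_lt.2 h.le)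
    · filter_upwards [hlim.eventually (Ioi_mem_nhds h)] with j hj
      exact iff_of_true hj h
  refine ⟨_, Measurable.liminf hGm, hle, (lintegral_liminf_le hGm).trans ?_⟩
  refine liminf_le_of_le (by isBoundedDefault) fun b hb => ?_
  obtain ⟨j, hj⟩ := hb.exists
  exact hj.trans (hGi' j)

/-- The coarea inequality. -/
theorem lintegral_perimeter_le {v : Rn n → ℝ} (hv : LocallyIntegrable v) :
    ∫⁻ t, perimeter {x | t < v x} ≤ totalVariation v := by
  obtain ⟨G, -, hG, hi⟩ := exists_ae_perimeter_majorant hv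
  exact (lintegral_mono_ae hG).trans hi

/-- A lower Riemann sum of a function on `ℝ` is at most its integral. -/
theorem sum_le_lintegral {g : ℝ → ℝ≥0∞} {h : ℝ} (hh : 0 < h) {N : ℕ} {a : ℕ → ℝ≥0∞}
    (H : ∀ j < N, ∀ t, h * j ≤ t → t < h * (j + 1) → a j ≤ g t) :
    ∑ j ∈ Finset.range N, ENNReal.ofReal h * a j ≤ ∫⁻ t, g t := by
  let I : ℕ → Set ℝ := fun j => Ico (h * j) (h * (j + 1))
  have hd : Pairwise (Function.onFun Disjoint I) := by
    have hm : Monotone fun j : ℕ => h * (j : ℝ) := fun i j hij => by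
      have : (i : ℝ) ≤ j := by exact_mod_cast hij
      exact mul_le_mul_of_nonneg_left this hh.le
    have := hm.pairwise_disjoint_on_Ico_succ
    simpa [I] using this
  calc ∑ j ∈ Finset.range N, ENNReal.ofReal h * a j
      = ∑ j ∈ Finset.range N, ∫⁻ _ in I j, a j := by
        refine Finset.sum_congr rfl fun j _ => ?_
        rw [setLIntegral_const, mul_comm, Real.volume_Ico]
        congr 2; ring
    _ ≤ ∑ j ∈ Finset.range N, ∫⁻ t in I j, g t :=
        Finset.sum_le_sum fun j hj => setLIntegral_mono' measurableSet_Ico fun t ht =>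
          H j (Finset.mem_range.1 hj) t ht.1 ht.2
    -- Additivity over the domain needs only measurable intervals, so `g` may be arbitrary.
    _ = ∫⁻ t in ⋃ j ∈ Finset.range N, I j, g t :=
        (lintegral_biUnion_finset (hd.set_pairwise _) (fun _ _ => measurableSet_Ico) g).symm
    _ ≤ ∫⁻ t, g t := setLIntegral_le_lintegral _ _

/-- The perimeter is submodular. -/
theorem perimeter_union_add_perimeter_inter_le {E F : Set (Rn n)} (hE : NullMeasurableSet E)
    (hF : NullMeasurableSet F) :
    perimeter (E ∪ F) + perimeter (E ∩ F) ≤ perimeter E + perimeter F := by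
  have hiE := locallyIntegrable_indicator_one hE
  have hiF := locallyIntegrable_indicator_one hF
  have h1 := totalVariation_add_le hiE hiF
  rw [← perimeter_eq_totalVariation hE, ← perimeter_eq_totalVariation hF] at h1
  refine le_trans ?_ ((lintegral_perimeter_le (hiE.add hiF)).trans h1)
  -- The superlevel set of `χ_E + χ_F` is `E ∪ F` for levels in `[0, 1)` and `E ∩ F` for levels in
  -- `[1, 2)`.
  have h2 := sum_le_lintegral (N := 2) one_pos
    (g := fun t => perimeter {x | t < (E.indicator (fun _ => (1 : ℝ)) + F.indicator (fun _ => (1 : ℝ))) x})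
    (a := fun j => if j = 0 then perimeter (E ∪ F) else perimeter (E ∩ F)) ?_
  · simpa [Finset.sum_range_succ] using h2
  intro j hj t ht1 ht2
  interval_cases j
  · simp only [if_true]
    refine le_of_eq (congrArg _ ?_)
    ext x
    simp only [Nat.cast_zero, mul_zero, zero_add, mul_one] at ht1 ht2
    by_cases h : x ∈ E <;> by_cases h' : x ∈ F <;> simp [h, h'] <;> linarith
  · simp only [one_ne_zero, if_false]
    refine le_of_eq (congrArg _ ?_)
    ext x
    simp only [Nat.cast_one, one_mul] at ht1 ht2
    by_cases h : x ∈ E <;> by_cases h' : x ∈ F <;> simp [h, h'] <;> linarith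

end Coarea

/-! ### Calibration by a unit field normal to level sets -/

section Calibration

variable {n : ℕ}

/-- The calibration inequality for a level set of `f` to which the unit field `-ξ` is normal. -/
theorem setIntegral_superlevel_add_le {f : Rn n → ℝ} (hf : ContDiff ℝ 1 f) {ξ : Rn n → Rn n}
    (hξ : IsTestField ξ) (hξ1 : ∀ x, ‖ξ x‖ ≤ 1) {s ε : ℝ} (hε : 0 < ε)
    (hcal : ∀ x, s < f x → f x < s + ε → fderiv ℝ f x (ξ x) ≤ -‖fderiv ℝ f x‖)
    {E : Set (Rn n)} (hE : perimeter E ≠ ∞) {η : Rn n → Rn n}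
    (hη : IsTestField η) (hη1 : ∀ x, ‖η x‖ ≤ 1) :
    (∫ x in E ∩ {x | s < f x}, divergence η x) + (∫ x in E ∩ {x | f x ≤ s}, divergence ξ x) ≤
      (perimeter E).toReal := by
  -- `φ k` interpolates between `η` on the superlevel set and the calibrating field `ξ` off it; its
  -- transition layer lies in the strip where `hcal` applies.
  let φ : ℕ → Rn n → ℝ := fun k x => smoothStep ((k + 1) / ε) s (f x)
  have hφ : ∀ k, ContDiff ℝ 1 (φ k) := fun k =>
    contDiff_smoothStep_comp (m := 1) (by exact_mod_cast hf) _ s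
  have hφ' : ∀ k, ContDiff ℝ 1 fun x => 1 - φ k x := fun k => contDiff_const.sub (hφ k)
  have hζ : ∀ k, IsTestField fun x => φ k x • η x + (1 - φ k x) • ξ x := fun k =>
    (hη.smul_left (hφ k)).add (hξ.smul_left (hφ' k))
  have hζ1 : ∀ k x, ‖φ k x • η x + (1 - φ k x) • ξ x‖ ≤ 1 := fun k x => by
    have h0 := smoothStep_nonneg ((k + 1) / ε) s (f x)
    have h1 := smoothStep_le_one ((k + 1) / ε) s (f x)
    calc ‖φ k x • η x + (1 - φ k x) • ξ x‖ ≤ ‖φ k x • η x‖ + ‖(1 - φ k x) • ξ x‖ := norm_add_le _ _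
      _ = φ k x * ‖η x‖ + (1 - φ k x) * ‖ξ x‖ := by
          rw [norm_smul, norm_smul, Real.norm_of_nonneg h0, Real.norm_of_nonneg (sub_nonneg.2 h1)]
      _ ≤ φ k x * 1 + (1 - φ k x) * 1 := by
          gcongr
          · exact hη1 x
          · exact hξ1 x
      _ = 1 := by ring
  have hdiv : ∀ k x, φ k x * divergence η x + (divergence ξ x - φ k x * divergence ξ x) ≤
      divergence (fun x => φ k x • η x + (1 - φ k x) • ξ x) x := fun k x => by
    have d1 := (hφ k).differentiable (by norm_num) x
    have d2 := (hφ' k).differentiable (by norm_num) x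
    rw [divergence_add (d1.fun_smul (hη.differentiable x)) (d2.fun_smul (hξ.differentiable x)),
      divergence_smul d1 (hη.differentiable x), divergence_smul d2 (hξ.differentiable x),
      fderiv_const_sub, fderiv_smoothStep_comp (hf.differentiable (by norm_num) x)]
    set A := (k + 1 : ℝ) / ε * stepDeriv ((k + 1) / ε * (f x - s)) with hA
    have hA0 : 0 ≤ A := mul_nonneg (by positivity) (stepDeriv_nonneg _)
    -- This is the contribution of the transition layer to the divergence. It has a sign because
    -- `Df(ξ) ≤ -|Df|` is the least value that any field of norm at most one can reach; off the
    -- strip the step is flat.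
    have key : 0 ≤ A * (fderiv ℝ f x (η x) - fderiv ℝ f x (ξ x)) := by
      by_cases h1 : s < f x ∧ f x < s + ε
      · refine mul_nonneg hA0 ?_
        have h2 := hcal x h1.1 h1.2
        have h3 : ‖fderiv ℝ f x (η x)‖ ≤ ‖fderiv ℝ f x‖ :=
          ((fderiv ℝ f x).le_opNorm _).trans (mul_le_of_le_one_right (norm_nonneg _) (hη1 x))
        have h4 := neg_abs_le (fderiv ℝ f x (η x))
        rw [Real.norm_eq_abs] at h3
        linarith
      · have hA1 : A = 0 := by
          rw [hA, stepDeriv_eq_zero, mul_zero]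
          rw [not_and_or, not_lt, not_lt] at h1
          rcases h1 with h1 | h1
          · exact Or.inl (mul_nonpos_of_nonneg_of_nonpos (by positivity) (by linarith))
          · refine Or.inr ?_
            rw [div_mul_eq_mul_div, le_div_iff₀ hε, one_mul]
            have : (0 : ℝ) ≤ k := by positivity
            nlinarith
        rw [hA1, zero_mul]
    simp only [smul_apply, neg_apply, smul_eq_mul]
    linarith
  have hIη := hη.integrable_divergence.integrableOn (s := E)
  have hIξ := hξ.integrable_divergence.integrableOn (s := E)
  have hm : MeasurableSet {x | s < f x} := (isOpen_lt continuous_const hf.continuous).measurableSet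
  have hφm : ∀ k, AEStronglyMeasurable (φ k) (volume.restrict E) := fun k =>
    (hφ k).continuous.aestronglyMeasurable
  have hmul : ∀ k {g : Rn n → ℝ}, IntegrableOn g E → IntegrableOn (fun x => φ k x * g x) E :=
    fun k g hg => hg.bdd_mul (c := 1) (hφm k) (ae_of_all _ fun x => by
      rw [Real.norm_of_nonneg (smoothStep_nonneg _ _ _)]; exact smoothStep_le_one _ _ _)
  have hle : ∀ k : ℕ, (∫ x in E, φ k x * divergence η x) +
      ((∫ x in E, divergence ξ x) - ∫ x in E, φ k x * divergence ξ x) ≤ (perimeter E).toReal :=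
    fun k => by
      refine le_trans ?_ (setIntegral_le_perimeter (hζ k) (hζ1 k) hE)
      have e : (∫ x in E, φ k x * divergence η x) +
          ((∫ x in E, divergence ξ x) - ∫ x in E, φ k x * divergence ξ x) =
          ∫ x in E, (φ k x * divergence η x + (divergence ξ x - φ k x * divergence ξ x)) := by
        rw [← integral_sub hIξ (hmul k hIξ)]
        exact (integral_add (hmul k hIη) (hIξ.sub (hmul k hIξ))).symm
      rw [e]
      exact integral_mono ((hmul k hIη).add (hIξ.sub (hmul k hIξ)))
        (hζ k).integrable_divergence.integrableOn (hdiv k)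
  have hlim := (tendsto_integral_smoothStep hε hf.continuous hIη s).add
    (tendsto_const_nhds (x := ∫ x in E, divergence ξ x) |>.sub
      (tendsto_integral_smoothStep hε hf.continuous hIξ s))
  have h5 := le_of_tendsto' hlim hle
  have h6 := integral_inter_add_sdiff hm hIξ
  have h7 : E \ {x | s < f x} = E ∩ {x | f x ≤ s} := by ext x; simp
  rw [h7] at h6
  linarith

/-- Cutting a set along a level set of `f` to which the unit field `-ξ` is normal. -/
theorem perimeter_inter_superlevel_le {f : Rn n → ℝ} (hf : ContDiff ℝ 1 f) {ξ : Rn n → Rn n}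
    (hξ : IsTestField ξ) (hξ1 : ∀ x, ‖ξ x‖ ≤ 1) {s ε : ℝ} (hε : 0 < ε)
    (hcal : ∀ x, s < f x → f x < s + ε → fderiv ℝ f x (ξ x) ≤ -‖fderiv ℝ f x‖)
    {E : Set (Rn n)} (hE : perimeter E ≠ ∞) :
    perimeter (E ∩ {x | s < f x}) ≤
      ENNReal.ofReal ((perimeter E).toReal - ∫ x in E ∩ {x | f x ≤ s}, divergence ξ x) := by
  rw [perimeter_le_iff]
  intro η hη hη1
  exact ENNReal.ofReal_le_ofReal (le_sub_iff_add_le.2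
    (setIntegral_superlevel_add_le hf hξ hξ1 hε hcal hE hη hη1))

end Calibration

/-! ### Isoperimetric inequality -/

section Isoperimetric

variable {n : ℕ}

/-- The isoperimetric inequality, with an unspecified constant. -/
theorem exists_isoperimetric_const (hn : 2 ≤ n) :
    ∃ C : ℝ, 0 < C ∧ ∀ E : Set (Rn n), NullMeasurableSet E → Bornology.IsBounded E →
      perimeter E ≠ ∞ → volume.real E ^ (n - 1) ≤ (C * (perimeter E).toReal) ^ n := by
  have hn1 : (1 : NNReal) < n := by exact_mod_cast (by omega : 1 < n)
  have hn0 : (n : ℝ) ≠ 0 := by positivity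
  -- `p = n/(n-1)` is the Gagliardo–Nirenberg–Sobolev exponent for gradients in `L¹`. The inequality
  -- is applied to mollified indicators; since `n/p = n - 1`, raising it to the power `n` gives the
  -- stated form.
  set p := (n : NNReal).conjExponent with hpdef
  have hp : NNReal.HolderConjugate (n : NNReal) p := NNReal.HolderConjugate.conjExponent hn1
  have hp0 : (0 : ℝ) < p := hp.coe.symm.pos
  have hpn : 1 / (p : ℝ) * n = (n - 1 : ℕ) := by
    have h1 : (n : ℝ)⁻¹ + (p : ℝ)⁻¹ = 1 := by
      simpa using congrArg NNReal.toReal (NNReal.holderConjugate_iff.1 hp).2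
    rw [one_div, show (p : ℝ)⁻¹ = 1 - (n : ℝ)⁻¹ by linarith, Nat.cast_sub (by omega)]
    field_simp
    simp
  let C₀ := eLpNormLESNormFDerivOneConst (volume : Measure (Rn n)) (p : ℝ)
  refine ⟨C₀ + 1, by positivity, fun E hE hb hP => ?_⟩
  obtain ⟨R, hR⟩ := hb.subset_closedBall (0 : Rn n)
  let v : Rn n → ℝ := E.indicator fun _ => 1
  have hv := locallyIntegrable_indicator_one hE
  have hvs : HasCompactSupport v := HasCompactSupport.intro (isCompact_closedBall (0 : Rn n) R)
    fun x hx => indicator_of_notMem (fun h => hx (hR h)) _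
  have hs : ∀ j, ContDiff ℝ 2 (mollify (stdBump n j) v) := fun j =>
    contDiff_mollify (stdBump n j) hv 2
  have hGN : ∀ j, eLpNorm (mollify (stdBump n j) v) p volume ≤ C₀ * perimeter E := fun j => by
    have h1 := eLpNorm_le_eLpNorm_fderiv_one (volume : Measure (Rn n)) (p := p)
      ((hs j).of_le (by norm_num))
      (HasCompactSupport.convolution _ (stdBump n j).hasCompactSupport_normed hvs) (by simpa using hp)
    refine h1.trans ?_
    rw [eLpNorm_one_eq_lintegral_enorm, perimeter_eq_totalVariation hE]
    gcongr
    exact (lintegral_enorm_fderiv_le (hs j)).trans (totalVariation_mollify_le _ hv)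
  have h2 : eLpNorm v p volume ≤ C₀ * perimeter E := by
    refine (Lp.eLpNorm_lim_le_liminf_eLpNorm
      (fun j => (hs j).continuous.aestronglyMeasurable) v (ae_tendsto_mollify hv)).trans ?_
    refine liminf_le_of_le (by isBoundedDefault) fun b hb => ?_
    obtain ⟨j, hj⟩ := hb.exists
    exact hj.trans (hGN j)
  rw [eLpNorm_indicator_const₀ hE (by exact_mod_cast hp0.ne') (by simp)] at h2
  simp only [enorm_one, one_mul, ENNReal.coe_toReal] at h2
  have h3 := ENNReal.toReal_mono (ENNReal.mul_ne_top ENNReal.coe_ne_top hP) h2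
  rw [← ENNReal.toReal_rpow, ENNReal.toReal_mul, ENNReal.coe_toReal] at h3
  have h4 : volume.real E ^ (n - 1) = ((volume E).toReal ^ (1 / (p : ℝ))) ^ n := by
    rw [← Real.rpow_natCast _ n, ← Real.rpow_mul ENNReal.toReal_nonneg, hpn, Real.rpow_natCast,
      measureReal_def]
  rw [h4]
  gcongr
  refine h3.trans ?_
  gcongr
  linarith

end Isoperimetric

/-! ### Economical cuts of sets of finite perimeter -/

section Slicing

variable {n : ℕ}

/-- Splitting a set of finite perimeter by a partition of unity `φ + (1 - φ) = 1`. -/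
theorem totalVariation_split_le {K B : Set (Rn n)} (hK : NullMeasurableSet K)
    (hP : perimeter K ≠ ∞) (hB : MeasurableSet B) (hBv : volume B ≠ ∞) {φ : Rn n → ℝ}
    (hφ : ContDiff ℝ 1 φ) (h0 : ∀ x, 0 ≤ φ x) (h1 : ∀ x, φ x ≤ 1) {L : ℝ}
    (hL : ∀ x, ‖fderiv ℝ φ x‖ ≤ L) (hLB : ∀ x ∉ B, fderiv ℝ φ x = 0) :
    totalVariation (fun x => φ x * K.indicator (fun _ => (1 : ℝ)) x) +
      totalVariation (fun x => (1 - φ x) * K.indicator (fun _ => (1 : ℝ)) x) ≤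
      perimeter K + ENNReal.ofReal (2 * L * volume.real (K ∩ B)) := by
  have hL0 : 0 ≤ L := (norm_nonneg _).trans (hL 0)
  set T : ℝ := (perimeter K).toReal + 2 * L * volume.real (K ∩ B) with hT
  have hT' : perimeter K + ENNReal.ofReal (2 * L * volume.real (K ∩ B)) = ENNReal.ofReal T := by
    rw [hT, ENNReal.ofReal_add ENNReal.toReal_nonneg (by positivity), ENNReal.ofReal_toReal hP]
  have hφ' : ContDiff ℝ 1 fun x => 1 - φ x := contDiff_const.sub hφ
  have hform : ∀ ψ : Rn n → ℝ, ∀ g : Rn n → ℝ,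
      ∫ x, ψ x * K.indicator (fun _ => (1 : ℝ)) x * g x = ∫ x in K, ψ x * g x := fun ψ g => by
    rw [setIntegral_eq_integral_indicator_mul hK]
    congr 1; ext x; ring
  -- Testing `K` with `φ η₁ + (1 - φ) η₂` introduces only the error `Dφ(η₁ - η₂)`, which is at most
  -- `2L` and vanishes off `B`.
  have key : ∀ η₁ η₂ : Rn n → Rn n, IsTestField η₁ → (∀ x, ‖η₁ x‖ ≤ 1) → IsTestField η₂ →
      (∀ x, ‖η₂ x‖ ≤ 1) →
      (∫ x in K, φ x * divergence η₁ x) + (∫ x in K, (1 - φ x) * divergence η₂ x) ≤ T := by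
    intro η₁ η₂ t₁ b₁ t₂ b₂
    have hζ : IsTestField fun x => φ x • η₁ x + (1 - φ x) • η₂ x :=
      (t₁.smul_left hφ).add (t₂.smul_left hφ')
    have hζ1 : ∀ x, ‖φ x • η₁ x + (1 - φ x) • η₂ x‖ ≤ 1 := fun x => by
      have h3 := sub_nonneg.2 (h1 x)
      calc ‖φ x • η₁ x + (1 - φ x) • η₂ x‖ ≤ ‖φ x • η₁ x‖ + ‖(1 - φ x) • η₂ x‖ := norm_add_le _ _
        _ = φ x * ‖η₁ x‖ + (1 - φ x) * ‖η₂ x‖ := by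
            rw [norm_smul, norm_smul, Real.norm_of_nonneg (h0 x), Real.norm_of_nonneg h3]
        _ ≤ φ x * 1 + (1 - φ x) * 1 := by
            gcongr
            · exact h0 x
            · exact b₁ x
            · exact b₂ x
        _ = 1 := by ring
    have hdiv : ∀ x, divergence (fun x => φ x • η₁ x + (1 - φ x) • η₂ x) x =
        φ x * divergence η₁ x + (1 - φ x) * divergence η₂ x + fderiv ℝ φ x (η₁ x - η₂ x) :=
      fun x => by
      have d1 := hφ.differentiable (by norm_num) x
      have d2 := hφ'.differentiable (by norm_num) x
      rw [divergence_add (d1.fun_smul (t₁.differentiable x)) (d2.fun_smul (t₂.differentiable x)),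
        divergence_smul d1 (t₁.differentiable x), divergence_smul d2 (t₂.differentiable x),
        fderiv_const_sub, neg_apply, map_sub]
      ring
    have hlow : ∀ x, φ x * divergence η₁ x + (1 - φ x) * divergence η₂ x ≤
        divergence (fun x => φ x • η₁ x + (1 - φ x) • η₂ x) x +
          B.indicator (fun _ => 2 * L) x := fun x => by
      rw [hdiv]
      have h3 : -fderiv ℝ φ x (η₁ x - η₂ x) ≤ B.indicator (fun _ => 2 * L) x := by
        by_cases hx : x ∈ B
        · rw [indicator_of_mem hx]
          refine (neg_le_abs _).trans ?_
          rw [← Real.norm_eq_abs]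
          calc ‖fderiv ℝ φ x (η₁ x - η₂ x)‖ ≤ ‖fderiv ℝ φ x‖ * ‖η₁ x - η₂ x‖ :=
                ContinuousLinearMap.le_opNorm _ _
            _ ≤ L * (1 + 1) := by
                gcongr
                · exact hL x
                · exact (norm_sub_le _ _).trans (add_le_add (b₁ x) (b₂ x))
            _ = 2 * L := by ring
        · simp [hLB x hx, hx]
      linarith
    have hi : ∀ {η : Rn n → Rn n}, IsTestField η → ∀ {ψ : Rn n → ℝ}, Continuous ψ →
        IntegrableOn (fun x => ψ x * divergence η x) K := fun hη _ hψ =>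
      ((hψ.mul hη.continuous_divergence).integrable_of_hasCompactSupport
        hη.hasCompactSupport_divergence.mul_left).integrableOn
    have i1 := hi t₁ hφ.continuous
    have i2 := hi t₂ hφ'.continuous
    have i3 := hζ.integrable_divergence.integrableOn (s := K)
    have i4 : IntegrableOn (B.indicator fun _ => 2 * L) K :=
      ((integrable_indicator_iff hB).2 (integrableOn_const hBv)).integrableOn
    calc _ = ∫ x in K, (φ x * divergence η₁ x + (1 - φ x) * divergence η₂ x) :=
          (integral_add i1 i2).symm
      _ ≤ ∫ x in K, (divergence (fun x => φ x • η₁ x + (1 - φ x) • η₂ x) x +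
          B.indicator (fun _ => 2 * L) x) := integral_mono (i1.add i2) (i3.add i4) hlow
      _ = (∫ x in K, divergence (fun x => φ x • η₁ x + (1 - φ x) • η₂ x) x) +
          ∫ x in K, B.indicator (fun _ => 2 * L) x := integral_add i3 i4
      _ ≤ T := by
          refine add_le_add (setIntegral_le_perimeter hζ hζ1 hP) (le_of_eq ?_)
          rw [setIntegral_indicator hB, setIntegral_const, smul_eq_mul, mul_comm]
  rw [hT']
  unfold totalVariation
  have hz : IsTestField (fun _ : Rn n => (0 : Rn n)) ∧ ∀ x : Rn n, ‖(0 : Rn n)‖ ≤ 1 :=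
    ⟨IsTestField.zero, by simp⟩
  refine ENNReal.biSup_add_biSup_le' ⟨fun _ => 0, hz⟩ ⟨fun _ => 0, hz⟩ fun η₁ H₁ η₂ H₂ => ?_
  simp only [hform]
  have hz0 : ∀ x : Rn n, divergence (fun _ : Rn n => (0 : Rn n)) x = 0 := fun x => by
    simp [divergence]
  -- `ENNReal.ofReal` truncates negative pairings; replacing one of the fields by zero covers those
  -- cases.
  have k1 := key η₁ _ H₁.1 H₁.2 hz.1 hz.2
  have k2 := key _ η₂ hz.1 hz.2 H₂.1 H₂.2
  have k3 := key η₁ η₂ H₁.1 H₁.2 H₂.1 H₂.2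
  simp only [hz0, mul_zero, integral_zero, add_zero, zero_add] at k1 k2
  rcases le_total 0 (∫ x in K, φ x * divergence η₁ x) with s1 | s1
  · rcases le_total 0 (∫ x in K, (1 - φ x) * divergence η₂ x) with s2 | s2
    · rw [← ENNReal.ofReal_add s1 s2]
      exact ENNReal.ofReal_le_ofReal k3
    · rw [ENNReal.ofReal_of_nonpos s2, add_zero]
      exact ENNReal.ofReal_le_ofReal k1
  · rw [ENNReal.ofReal_of_nonpos s1, zero_add]
    exact ENNReal.ofReal_le_ofReal k2

/-- Some superlevel set of a cutoff function cuts a set of finite perimeter economically. -/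
theorem exists_slice {K B : Set (Rn n)} (hK : NullMeasurableSet K)
    (hP : perimeter K ≠ ∞) (hB : MeasurableSet B) (hBv : volume B ≠ ∞) {φ : Rn n → ℝ}
    (hφ : ContDiff ℝ 1 φ) (h0 : ∀ x, 0 ≤ φ x) (h1 : ∀ x, φ x ≤ 1) {L : ℝ}
    (hL : ∀ x, ‖fderiv ℝ φ x‖ ≤ L) (hLB : ∀ x ∉ B, fderiv ℝ φ x = 0) :
    ∃ t : ℝ, 0 < t ∧ t < 1 ∧ perimeter (K ∩ {x | t < φ x}) + perimeter (K \ {x | t < φ x}) ≤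
      perimeter K + ENNReal.ofReal (2 * L * volume.real (K ∩ B)) := by
  have hi := locallyIntegrable_indicator_one hK
  have hl : ∀ ψ : Rn n → ℝ, Continuous ψ →
      LocallyIntegrable fun x => ψ x * K.indicator (fun _ => (1 : ℝ)) x := fun ψ hψ => by
    have := hi.continuous_smul hψ
    exact this
  obtain ⟨G₁, m₁, p₁, l₁⟩ := exists_ae_perimeter_majorant (hl φ hφ.continuous)
  obtain ⟨G₂, m₂, p₂, l₂⟩ := exists_ae_perimeter_majorant
    (hl (fun x => 1 - φ x) (continuous_const.sub hφ.continuous))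
  -- The level is reflected: on `K`, `1 - φ > 1 - t` means `φ < t`, so both majorants concern the
  -- same cut, up to the level set `{φ = t}`.
  have hp₂ : ∀ᵐ t : ℝ, perimeter {x | 1 - t < (1 - φ x) * K.indicator (fun _ => (1 : ℝ)) x} ≤
      G₂ (1 - t) :=
    (Measure.measurePreserving_sub_left volume (1 : ℝ)).quasiMeasurePreserving.ae p₂
  have hlev : ∀ᵐ t : ℝ, volume {x | φ x = t} = 0 := by
    have h1 := (Measure.countable_meas_level_set_pos₀ (μ := (volume : Measure (Rn n)))
      hφ.continuous.measurable.nullMeasurable).ae_notMem (volume : Measure ℝ)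
    filter_upwards [h1] with t ht
    simpa using ht
  let μ : Measure ℝ := volume.restrict (Ioo 0 1)
  have : IsProbabilityMeasure μ := ⟨by simp [μ]⟩
  have hgood : ∀ᵐ t ∂μ, t ∈ Ioo (0 : ℝ) 1 ∧ (perimeter {x | t < φ x * K.indicator (fun _ => (1 : ℝ)) x} ≤
      G₁ t ∧ perimeter {x | 1 - t < (1 - φ x) * K.indicator (fun _ => (1 : ℝ)) x} ≤
      G₂ (1 - t) ∧ volume {x | φ x = t} = 0) :=
    (ae_restrict_mem measurableSet_Ioo).and
      (ae_restrict_of_ae (p₁.and (hp₂.and hlev)))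
  have hGm : Measurable fun t => G₁ t + G₂ (1 - t) :=
    m₁.add (m₂.comp (measurable_const.sub measurable_id))
  -- Some admissible level does no worse than the mean over `(0, 1)`. This averaging is the reason
  -- for having measurable majorants.
  obtain ⟨t, ht, hle⟩ := exists_notMem_null_le_lintegral (μ := μ) hGm.aemeasurable (ae_iff.1 hgood)
  obtain ⟨⟨ht0, ht1⟩, q₁, q₂, q₃⟩ := not_not.1 ht
  refine ⟨t, ht0, ht1, ?_⟩
  have e₁ : {x | t < φ x * K.indicator (fun _ => (1 : ℝ)) x} = K ∩ {x | t < φ x} := by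
    ext x
    by_cases hx : x ∈ K <;> simp [hx, ht0.le]
  have e₂ : {x | 1 - t < (1 - φ x) * K.indicator (fun _ => (1 : ℝ)) x} =ᵐ[volume]
      (K \ {x | t < φ x} : Set (Rn n)) := by
    have : ∀ᵐ x, φ x ≠ t := by rw [ae_iff]; simpa using q₃
    filter_upwards [this] with x hx
    refine propext ?_
    change 1 - t < (1 - φ x) * K.indicator (fun _ => (1 : ℝ)) x ↔ x ∈ K ∧ ¬ t < φ x
    by_cases hxK : x ∈ K
    · simp only [hxK, indicator_of_mem, mul_one, true_and, not_lt]
      constructor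
      · intro h; linarith
      · intro h
        have := lt_of_le_of_ne h hx
        linarith
    · simp [hxK, ht1.le]
  rw [e₁] at q₁
  rw [perimeter_congr e₂] at q₂
  refine (add_le_add q₁ q₂).trans (hle.trans ?_)
  refine le_trans ?_ (totalVariation_split_le hK hP hB hBv hφ h0 h1 hL hLB)
  rw [lintegral_add_left m₁]
  refine add_le_add ((setLIntegral_le_lintegral _ _).trans l₁)
    ((setLIntegral_le_lintegral _ _).trans (le_of_eq_of_le ?_ l₂))
  exact lintegral_sub_left_eq_self G₂ 1

/-- A bound for the slope of `Real.smoothTransition`. -/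
theorem exists_stepDeriv_le : ∃ M : ℝ, 0 < M ∧ ∀ y, stepDeriv y ≤ M := by
  obtain ⟨M, hM⟩ := (isCompact_Icc (a := (0 : ℝ)) (b := 1)).exists_bound_of_continuousOn
    continuous_stepDeriv.continuousOn
  refine ⟨max M 1, by positivity, fun y => ?_⟩
  by_cases hy : y ∈ Icc (0 : ℝ) 1
  · exact (le_abs_self _).trans ((hM y hy).trans (le_max_left _ _))
  · rw [mem_Icc, not_and_or, not_le, not_le] at hy
    rw [stepDeriv_eq_zero (hy.imp le_of_lt le_of_lt)]
    positivity

theorem hasFDerivAt_norm_sub_sq (x₀ x : Rn n) :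
    HasFDerivAt (fun x => ‖x - x₀‖ ^ 2) (2 • innerSL ℝ (x - x₀)) x := by
  have h : HasFDerivAt (fun x : Rn n => x - x₀) (ContinuousLinearMap.id ℝ (Rn n)) x :=
    (hasFDerivAt_id x).sub_const x₀
  simpa using h.norm_sq

theorem contDiff_norm_sub_sq (x₀ : Rn n) {m : ℕ∞} : ContDiff ℝ m fun x => ‖x - x₀‖ ^ 2 :=
  (contDiff_id.sub contDiff_const).norm_sq ℝ

/-- Cutting by a ball of a radius between `s` and `r`. -/
theorem exists_ball_slice (n : ℕ) : ∃ M : ℝ, 0 < M ∧ ∀ (K : Set (Rn n)) (x₀ : Rn n) (s r : ℝ),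
    NullMeasurableSet K → perimeter K ≠ ∞ → 0 ≤ s → s < r →
    ∃ A : Set (Rn n), IsOpen A ∧ Metric.ball x₀ s ⊆ A ∧ A ⊆ Metric.ball x₀ r ∧
      perimeter (K ∩ A) + perimeter (K \ A) ≤
        perimeter K + ENNReal.ofReal (M / (r - s) * volume.real (K ∩ Metric.ball x₀ r)) := by
  obtain ⟨M, hM0, hM⟩ := exists_stepDeriv_le
  -- The cutoff has slope at most `2M/(r - s)`, and `exists_slice` doubles the slope.
  refine ⟨4 * M, by positivity, fun K x₀ s r hK hP hs hsr => ?_⟩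
  have hr : 0 < r := hs.trans_lt hsr
  have hrs : 0 < r ^ 2 - s ^ 2 := by nlinarith
  -- The squared norm keeps the cutoff smooth at the center.
  let f : Rn n → ℝ := fun x => -‖x - x₀‖ ^ 2
  have hf : ContDiff ℝ 1 f := (contDiff_norm_sub_sq x₀ (m := 1)).neg
  let c : ℝ := 1 / (r ^ 2 - s ^ 2)
  have hc : 0 < c := by positivity
  let φ : Rn n → ℝ := fun x => smoothStep c (-r ^ 2) (f x)
  have hφ : ContDiff ℝ 1 φ := contDiff_smoothStep_comp (m := 1) (by exact_mod_cast hf) _ _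
  have hfd : ∀ x, fderiv ℝ f x = -(2 • innerSL ℝ (x - x₀)) := fun x =>
    (hasFDerivAt_norm_sub_sq x₀ x).fun_neg.fderiv
  have hφd : ∀ x, fderiv ℝ φ x = (c * stepDeriv (c * (f x - -r ^ 2))) • fderiv ℝ f x := fun x =>
    fderiv_smoothStep_comp (hf.differentiable (by norm_num) x) _ _
  have hout : ∀ x ∉ Metric.ball x₀ r, c * (f x - -r ^ 2) ≤ 0 := fun x hx => by
    rw [Metric.mem_ball, dist_eq_norm, not_lt] at hx
    refine mul_nonpos_of_nonneg_of_nonpos hc.le ?_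
    simp only [f]
    nlinarith
  have hLB : ∀ x ∉ Metric.ball x₀ r, fderiv ℝ φ x = 0 := fun x hx => by
    rw [hφd, stepDeriv_eq_zero (Or.inl (hout x hx)), mul_zero, zero_smul]
  have hL : ∀ x, ‖fderiv ℝ φ x‖ ≤ 2 * M / (r - s) := fun x => by
    by_cases hx : x ∈ Metric.ball x₀ r
    · rw [hφd, norm_smul, Real.norm_of_nonneg (mul_nonneg hc.le (stepDeriv_nonneg _)), hfd, norm_neg]
      rw [Metric.mem_ball, dist_eq_norm] at hx
      have h2 : ‖(2 • innerSL ℝ (x - x₀) : Rn n →L[ℝ] ℝ)‖ ≤ 2 * r := by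
        rw [two_smul]
        refine (norm_add_le _ _).trans ?_
        rw [innerSL_apply_norm]
        linarith
      calc _ ≤ c * M * (2 * r) := by
            gcongr
            exact hM _
        _ ≤ 2 * M / (r - s) := by
            rw [le_div_iff₀ (by linarith)]
            have : c * (r ^ 2 - s ^ 2) = 1 := by simp only [c]; field_simp
            -- The left side is `r/(r + s)`.
            have h3 : c * ((r - s) * r) ≤ 1 := by
              rw [← this]
              gcongr
              nlinarith
            calc c * M * (2 * r) * (r - s) = 2 * M * (c * ((r - s) * r)) := by ring
              _ ≤ 2 * M * 1 := by gcongr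
              _ = 2 * M := mul_one _
    · rw [hLB x hx, norm_zero]
      have : 0 < r - s := by linarith
      positivity
  obtain ⟨t, ht0, ht1, ht⟩ := exists_slice hK hP Metric.isOpen_ball.measurableSet
    (Metric.isBounded_ball (x := x₀) (r := r)).measure_lt_top.ne hφ (fun x => smoothStep_nonneg _ _ _)
    (fun x => smoothStep_le_one _ _ _) hL hLB
  refine ⟨{x | t < φ x}, isOpen_lt continuous_const hφ.continuous, fun x hx => ?_, fun x hx => ?_, ?_⟩
  · have : φ x = 1 := by
      refine Real.smoothTransition.one_of_one_le ?_
      rw [Metric.mem_ball, dist_eq_norm] at hx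
      have h5 : r ^ 2 - s ^ 2 ≤ f x - -r ^ 2 := by
        simp only [f]
        nlinarith [norm_nonneg (x - x₀)]
      calc 1 = c * (r ^ 2 - s ^ 2) := by simp only [c]; field_simp
        _ ≤ _ := by gcongr
    simpa [this] using ht1
  · by_contra hx'
    have : φ x = 0 := Real.smoothTransition.zero_of_nonpos (hout x hx')
    have h6 : t < φ x := hx
    linarith
  · convert ht using 4
    ring

end Slicing

/-! ### De Giorgi density estimate -/

section Density

/-- De Giorgi's iteration for volumes in shrinking balls. -/
theorem deGiorgi_iteration {k : ℕ} (hk : k ≠ 0) {D R : ℝ} (hD : 0 < D) (hR : 0 < R) {m : ℕ → ℝ}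
    (hm : ∀ i, 0 ≤ m i) (hstep : ∀ i, m (i + 1) ^ k ≤ (D * 2 ^ i / R * m i) ^ (k + 1))
    (h0 : m 0 ≤ R ^ (k + 1) / (D ^ (k + 1) * 2 ^ (k * (k + 1)))) :
    ∀ i, m i ≤ R ^ (k + 1) / (D ^ (k + 1) * 2 ^ (k * (k + 1))) * ((1 / 2) ^ (k + 1)) ^ i := by
  -- The claimed bound is `a q^i` with `q = 2^{-(k+1)}`, and `a` is such that `a (D/R)^(k+1) = q^k`.
  -- Inserted into the recursion it reproduces itself with equality.
  intro i
  induction i with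
  | zero => simpa using h0
  | succ i ih =>
    refine (pow_le_pow_iff_left₀ (hm _) (by positivity) hk).1 ?_
    refine (hstep i).trans ?_
    have h1 : D * 2 ^ i / R * m i ≤ D * 2 ^ i / R *
        (R ^ (k + 1) / (D ^ (k + 1) * 2 ^ (k * (k + 1))) * ((1 / 2) ^ (k + 1)) ^ i) := by gcongr
    refine (pow_le_pow_left₀ (by have := hm i; positivity) h1 _).trans (le_of_eq ?_)
    have e2 : ((1 : ℝ) / 2) = 2⁻¹ := by norm_num
    simp only [e2, inv_pow, mul_pow, div_pow, ← pow_mul]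
    field_simp
    ring

variable {n : ℕ}

/-- If removing subsets of a ball from `K` decreases the perimeter by at most a small multiple of
the volume, and `K` has small density in the ball, then `K` is null in the concentric ball of
half the radius. -/
theorem exists_density_const (hn : 2 ≤ n) : ∃ ε : ℝ, 0 < ε ∧ ∀ (K : Set (Rn n)) (x₀ : Rn n)
    (R Λ : ℝ), NullMeasurableSet K → perimeter K ≠ ∞ → 0 < R → 0 ≤ Λ → Λ * R ≤ 1 →
    (∀ A : Set (Rn n), IsOpen A → A ⊆ Metric.ball x₀ R →
      perimeter K ≤ perimeter (K \ A) + ENNReal.ofReal (Λ * volume.real (K ∩ A))) →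
    volume.real (K ∩ Metric.ball x₀ R) ≤ ε * R ^ n → volume (K ∩ Metric.ball x₀ (R / 2)) = 0 := by
  obtain ⟨k, rfl⟩ : ∃ k, n = k + 1 := ⟨n - 1, by omega⟩
  have hk : k ≠ 0 := by omega
  obtain ⟨C, hC0, hC⟩ := exists_isoperimetric_const hn
  obtain ⟨M, hM0, hM⟩ := exists_ball_slice (k + 1)
  simp only [Nat.add_sub_cancel] at hC
  -- `C` is isoperimetric, `M` comes from the cut, the `1` absorbs `Λ` through `ΛR ≤ 1`, and `4`
  -- comes from the gaps between the radii.
  let D : ℝ := C * (M + 1) * 4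
  have hD : 0 < D := by positivity
  refine ⟨1 / (D ^ (k + 1) * 2 ^ (k * (k + 1))), by positivity, ?_⟩
  intro K x₀ R Λ hK hP hR hΛ hΛR hmin hsmall
  -- The radii decrease from `R` to `R/2` with gaps `R/(4·2^i)`.
  let r : ℕ → ℝ := fun i => R / 2 * (1 + (1 / 2) ^ i)
  have hr0 : ∀ i, R / 2 ≤ r i := fun i => by
    have : (0 : ℝ) ≤ (1 / 2) ^ i := by positivity
    simp only [r]; nlinarith
  have hrR : ∀ i, r i ≤ R := fun i => by
    have : ((1 : ℝ) / 2) ^ i ≤ 1 := pow_le_one₀ (by norm_num) (by norm_num)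
    simp only [r]; nlinarith
  have hrd : ∀ i, r i - r (i + 1) = R / (4 * 2 ^ i) := fun i => by
    simp only [r, pow_succ, one_div, inv_pow]
    field_simp
    ring
  have hrd0 : ∀ i, 0 < r i - r (i + 1) := fun i => by rw [hrd]; positivity
  have hfin : ∀ S : Set (Rn (k + 1)), ∀ ρ : ℝ, S ⊆ Metric.ball x₀ ρ → volume S ≠ ∞ := fun S ρ h =>
    ((measure_mono h).trans_lt Metric.isBounded_ball.measure_lt_top).ne
  let m : ℕ → ℝ := fun i => volume.real (K ∩ Metric.ball x₀ (r i))
  have hstep : ∀ i, m (i + 1) ^ k ≤ (D * 2 ^ i / R * m i) ^ (k + 1) := fun i => by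
    obtain ⟨A, hAo, hA1, hA2, hA⟩ := hM K x₀ (r (i + 1)) (r i) hK hP
      ((half_pos hR).le.trans (hr0 _)) (by linarith [hrd0 i])
    have hAR : A ⊆ Metric.ball x₀ R := hA2.trans (Metric.ball_subset_ball (hrR i))
    have hmA := hmin A hAo hAR
    have hKA : volume.real (K ∩ A) ≤ m i :=
      measureReal_mono (inter_subset_inter_right _ hA2) (hfin _ _ inter_subset_right)
    have hm0 : 0 ≤ m i := measureReal_nonneg
    set p := perimeter (K \ A)
    have hp : p ≠ ∞ := by
      have : p ≤ perimeter K + ENNReal.ofReal (M / (r i - r (i + 1)) * m i) :=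
        le_trans le_add_self hA
      exact (this.trans_lt (ENNReal.add_lt_top.2 ⟨hP.lt_top, ENNReal.ofReal_lt_top⟩)).ne
    -- Combining the cut with almost minimality against `K \ A` cancels both `P(K)` and `P(K \ A)`,
    -- so the perimeter of `K ∩ A` is controlled by volume alone; the isoperimetric inequality then
    -- yields a superlinear recursion.
    have h1 : perimeter (K ∩ A) ≤ ENNReal.ofReal (Λ * m i + M / (r i - r (i + 1)) * m i) := by
      rw [ENNReal.ofReal_add (by positivity) (by have := hrd0 i; positivity)]
      refine (ENNReal.add_le_add_iff_right hp).1 (hA.trans ?_)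
      calc _ ≤ (p + ENNReal.ofReal (Λ * volume.real (K ∩ A))) +
            ENNReal.ofReal (M / (r i - r (i + 1)) * m i) := by gcongr
        _ ≤ (p + ENNReal.ofReal (Λ * m i)) + ENNReal.ofReal (M / (r i - r (i + 1)) * m i) := by
            gcongr
        _ = _ := by ring
    have hb : Bornology.IsBounded (K ∩ A) := (Metric.isBounded_ball).subset
      (inter_subset_right.trans hA2)
    have h2 := hC (K ∩ A) (hK.inter hAo.measurableSet.nullMeasurableSet) hb
      (h1.trans_lt ENNReal.ofReal_lt_top).ne
    have h3 : (perimeter (K ∩ A)).toReal ≤ (M + 1) * 4 * 2 ^ i / R * m i := by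
      refine (ENNReal.toReal_le_of_le_ofReal (by have := hrd0 i; positivity) h1).trans ?_
      rw [← add_mul, hrd]
      refine mul_le_mul_of_nonneg_right ?_ hm0
      have h4 : Λ ≤ 1 / R := (le_div_iff₀ hR).2 hΛR
      have h5 : (1 : ℝ) ≤ 2 ^ i := one_le_pow₀ (by norm_num)
      calc Λ + M / (R / (4 * 2 ^ i)) ≤ 1 * (4 * 2 ^ i) / R + M * (4 * 2 ^ i) / R := by
            refine add_le_add (h4.trans ?_) (le_of_eq (by field_simp))
            gcongr
            linarith
        _ = _ := by ring
    have h6 : m (i + 1) ≤ volume.real (K ∩ A) :=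
      measureReal_mono (inter_subset_inter_right _ hA1) (hfin _ _ (inter_subset_right.trans hA2))
    calc m (i + 1) ^ k ≤ volume.real (K ∩ A) ^ k := pow_le_pow_left₀ measureReal_nonneg h6 _
      _ ≤ _ := h2
      _ ≤ (C * ((M + 1) * 4 * 2 ^ i / R * m i)) ^ (k + 1) := by gcongr
      _ = _ := by
          congr 1
          simp only [D]; ring
  have h0 : m 0 ≤ R ^ (k + 1) / (D ^ (k + 1) * 2 ^ (k * (k + 1))) := by
    have e : r 0 = R := by simp only [r]; ring
    simp only [m, e]
    refine hsmall.trans (le_of_eq ?_)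
    ring
  have hit := deGiorgi_iteration hk hD hR (m := m) (fun i => measureReal_nonneg) hstep h0
  have hlim : Tendsto (fun i : ℕ => R ^ (k + 1) / (D ^ (k + 1) * 2 ^ (k * (k + 1))) *
      (((1 : ℝ) / 2) ^ (k + 1)) ^ i) atTop (𝓝 0) := by
    have := (tendsto_pow_atTop_nhds_zero_of_lt_one (r := ((1 : ℝ) / 2) ^ (k + 1)) (by positivity)
      (pow_lt_one₀ (by norm_num) (by norm_num) (by omega))).const_mul
        (R ^ (k + 1) / (D ^ (k + 1) * 2 ^ (k * (k + 1))))
    simpa using this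
  have hle : ∀ i, volume.real (K ∩ Metric.ball x₀ (R / 2)) ≤ m i := fun i =>
    measureReal_mono (inter_subset_inter_right _ (Metric.ball_subset_ball (hr0 i)))
      (hfin _ _ inter_subset_right)
  have hz : volume.real (K ∩ Metric.ball x₀ (R / 2)) = 0 :=
    le_antisymm (ge_of_tendsto' hlim fun i => (hle i).trans (hit i)) measureReal_nonneg
  exact (measureReal_eq_zero_iff (hfin _ _ inter_subset_right)).1 hz

end Density

/-! ### Normalized representatives -/

section Normalized

variable {n : ℕ}

/-- Gauss–Green gives `∫ g ν dm = 0` for all smooth `g` with compact support in `U`, so `ν = 0`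
holds `m`-a.e. on `U`. With `|ν| = 1` this forces `m(U) = 0`, whereas balls around a reduced
boundary point have positive mass. Any pair `(m, ν)` is handled, so uniqueness plays no role. -/
theorem notMem_reducedBoundary_of_null {E U : Set (Rn n)} (hE : NullMeasurableSet E)
    (hU : IsOpen U) (h : volume (E ∩ U) = 0) {x : Rn n} (hx : x ∈ U) : x ∉ reducedBoundary E := by
  rintro ⟨m, ν, ⟨hm, hν, hν1, hG⟩, hpos, -⟩
  have hloc : LocallyIntegrable ν m := by
    have h1 : LocallyIntegrable (fun _ : Rn n => (1 : ℝ)) m := locallyIntegrable_const 1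
    refine h1.mono hν.aestronglyMeasurable ?_
    filter_upwards [hν1] with y hy
    simp [hy]
  have hz : ∀ᵐ y ∂m, y ∈ U → ν y = 0 := by
    refine hU.ae_eq_zero_of_integral_contDiff_smul_eq_zero (hloc.locallyIntegrableOn U)
      fun g hg hgs hgU => ?_
    have hint : Integrable (fun y => g y • ν y) m :=
      hloc.integrable_smul_left_of_hasCompactSupport hg.continuous hgs
    ext i
    have e1 : (∫ y, g y • ν y ∂m) i = ∫ y, (g y • ν y) i ∂m :=
      ((EuclideanSpace.proj i : Rn n →L[ℝ] ℝ).integral_comp_comm hint).symm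
    have hξ : IsTestField fun y => g y • (EuclideanSpace.single i 1 : Rn n) :=
      IsTestField.smul_right contDiff_const (hg.of_le (by norm_cast)) hgs
    have e2 := hG _ hξ
    have e3 : ∫ y in E, divergence (fun y => g y • (EuclideanSpace.single i 1 : Rn n)) y = 0 := by
      rw [setIntegral_eq_integral_indicator_mul hE]
      refine integral_eq_zero_of_ae ?_
      filter_upwards [measure_eq_zero_iff_ae_notMem.1 h] with y hy
      by_cases hyE : y ∈ E
      · have hyU : y ∉ U := fun h' => hy ⟨hyE, h'⟩
        rw [divergence_eq_zero_of_notMem_tsupport, mul_zero, Pi.zero_apply]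
        intro h'
        refine hyU (hgU (closure_mono ?_ h'))
        intro z hz hz'
        exact hz (by simp [hz'])
      · simp [hyE]
    rw [e1]
    rw [e3] at e2
    rw [PiLp.zero_apply, e2]
    refine integral_congr_ae (ae_of_all _ fun y => ?_)
    simp [inner_smul_left, EuclideanSpace.inner_single_left]
  obtain ⟨r, hr, hball⟩ := Metric.isOpen_iff.1 hU x hx
  refine (hpos r hr).ne' (measure_eq_zero_iff_ae_notMem.2 ?_)
  filter_upwards [hz, hν1] with y hy hy1 hyb
  rw [hy (hball hyb), norm_zero] at hy1
  exact zero_ne_one hy1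

/-- This turns null-set statements into pointwise ones. `U` misses the reduced boundary, hence its
closure `∂E`, and an interior point of `E` in `U` would produce positive volume. -/
theorem IsNormalized.notMem_closure {E U : Set (Rn n)} (hN : IsNormalized E)
    (hE : NullMeasurableSet E) (hU : IsOpen U) (h : volume (E ∩ U) = 0) {x : Rn n} (hx : x ∈ U) :
    x ∉ closure E := by
  have h1 : ∀ y ∈ U, y ∉ frontier E := fun y hy hyf => by
    rw [← hN, mem_closure_iff] at hyf
    obtain ⟨z, hzU, hz⟩ := hyf U hU hy
    exact notMem_reducedBoundary_of_null hE hU h hzU hz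
  intro hxc
  have hxi : x ∈ interior E := by
    by_contra hxi
    exact h1 x hx ⟨hxc, hxi⟩
  have h2 : 0 < volume (interior E ∩ U) := (isOpen_interior.inter hU).measure_pos _ ⟨x, hxi, hx⟩
  exact h2.ne' (measure_mono_null (inter_subset_inter_left _ interior_subset) h)

end Normalized

/-! ### The radial field and comparison with balls -/

section Radial

variable {n : ℕ}

theorem divergence_sub_const (x₀ x : Rn n) : divergence (fun x => x - x₀) x = n := by
  simp [divergence, fderiv_sub_const]

/-- The bump vanishes near the singularity of `1/√y`. Evaluated at `y = |x|²` this is a smooth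
cutoff of `1/|x|`. -/
theorem contDiff_bump_mul_inv_sqrt {c : ℝ} (ψ : ContDiffBump c) (h : ψ.rOut < c) :
    ContDiff ℝ 1 fun y => ψ y * (√y)⁻¹ := by
  rw [contDiff_iff_contDiffAt]
  intro y
  by_cases hy : y ∈ tsupport ψ
  · rw [ψ.tsupport_eq, Metric.mem_closedBall, Real.dist_eq, abs_le] at hy
    have hy0 : 0 < y := by linarith
    exact ψ.contDiff.contDiffAt.mul
      ((contDiffAt_id.sqrt hy0.ne').inv (Real.sqrt_pos.2 hy0).ne')
  · refine ContDiffAt.congr_of_eventuallyEq (f := fun _ => (0 : ℝ)) contDiffAt_const ?_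
    filter_upwards [(isClosed_tsupport ψ).isOpen_compl.mem_nhds hy] with z hz
    rw [image_eq_zero_of_notMem_tsupport hz, zero_mul]

theorem hasFDerivAt_inv_norm {x : Rn n} (hx : x ≠ 0) :
    HasFDerivAt (fun y : Rn n => (√(‖y‖ ^ 2))⁻¹)
      ((-(1 / (2 * √(‖x‖ ^ 2))) / √(‖x‖ ^ 2) ^ 2) • (2 • innerSL ℝ x)) x := by
  have h0 : ‖x‖ ^ 2 ≠ 0 := by simpa using hx
  have h1 : HasDerivAt (fun s => (√s)⁻¹) (-(1 / (2 * √(‖x‖ ^ 2))) / √(‖x‖ ^ 2) ^ 2) (‖x‖ ^ 2) :=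
    (Real.hasDerivAt_sqrt h0).fun_inv (Real.sqrt_ne_zero'.2 (by positivity))
  have h2 := hasFDerivAt_norm_sub_sq (0 : Rn n) x
  simp only [sub_zero] at h2
  exact HasDerivAt.comp_hasFDerivAt (h₂ := fun s : ℝ => (√s)⁻¹) x h1 h2

/-- A compactly supported cutoff of the radial unit field. -/
theorem exists_radial_field (n : ℕ) {a b : ℝ} (ha : 0 < a) (hab : a < b) :
    ∃ ξ : Rn n → Rn n, IsTestField ξ ∧ (∀ x, ‖ξ x‖ ≤ 1) ∧
      (∀ x, a ≤ ‖x‖ ^ 2 → ‖x‖ ^ 2 ≤ b → ξ x = ‖x‖⁻¹ • x) ∧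
      ∀ x, a < ‖x‖ ^ 2 → ‖x‖ ^ 2 < b → divergence ξ x = (n - 1) / ‖x‖ := by
  -- Equal to one on `[a, b]` and supported in `[a/2, b + a/2]`, away from zero.
  let ψ : ContDiffBump ((a + b) / 2) :=
    ⟨(b - a) / 2, (b - a) / 2 + a / 2, by linarith, by linarith⟩
  have hψ : ψ.rOut < (a + b) / 2 := by simp only [ψ]; linarith
  let β : ℝ → ℝ := fun y => ψ y * (√y)⁻¹
  have hβ : ContDiff ℝ 1 β := contDiff_bump_mul_inv_sqrt ψ hψ
  have hn : ContDiff ℝ 1 fun x : Rn n => ‖x‖ ^ 2 := contDiff_id.norm_sq ℝ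
  have hψ1 : ∀ y, a ≤ y → y ≤ b → ψ y = 1 := fun y h1 h2 => by
    refine ψ.one_of_mem_closedBall ?_
    simp only [ψ, Metric.mem_closedBall, Real.dist_eq, abs_le]
    constructor <;> linarith
  have hξeq : ∀ x : Rn n, a ≤ ‖x‖ ^ 2 → ‖x‖ ^ 2 ≤ b → β (‖x‖ ^ 2) • x = ‖x‖⁻¹ • x :=
    fun x h1 h2 => by
      simp only [β]
      rw [hψ1 _ h1 h2, Real.sqrt_sq (norm_nonneg _), one_mul]
  have hcs : HasCompactSupport fun x : Rn n => β (‖x‖ ^ 2) := by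
    refine HasCompactSupport.intro (isCompact_closedBall (0 : Rn n) (b + 1)) fun x hx => ?_
    rw [mem_closedBall_zero_iff, not_le] at hx
    have : ψ (‖x‖ ^ 2) = 0 := ψ.zero_of_le_dist (by
      simp only [ψ, Real.dist_eq]
      refine le_trans ?_ (le_abs_self _)
      nlinarith)
    simp only [β, this, zero_mul]
  refine ⟨fun x => β (‖x‖ ^ 2) • x, IsTestField.smul_right contDiff_id (hβ.comp hn) hcs,
    fun x => ?_, hξeq, fun x h1 h2 => ?_⟩
  · simp only [β]
    rw [Real.sqrt_sq (norm_nonneg _), norm_smul, norm_mul, norm_inv, norm_norm,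
      Real.norm_of_nonneg ψ.nonneg, mul_assoc]
    refine mul_le_one₀ ψ.le_one (by positivity) ?_
    exact inv_mul_le_one
  · have hx : x ≠ 0 := by
      rintro rfl
      simp at h1
      linarith
    have hx' : 0 < ‖x‖ := norm_pos_iff.2 hx
    have hev : (fun x : Rn n => β (‖x‖ ^ 2) • x) =ᶠ[𝓝 x] fun y => (√(‖y‖ ^ 2))⁻¹ • (y - 0) := by
      have ho : IsOpen {y : Rn n | a < ‖y‖ ^ 2 ∧ ‖y‖ ^ 2 < b} :=
        (isOpen_lt continuous_const hn.continuous).inter (isOpen_lt hn.continuous continuous_const)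
      filter_upwards [ho.mem_nhds ⟨h1, h2⟩] with y hy
      rw [hξeq y hy.1.le hy.2.le, Real.sqrt_sq (norm_nonneg _), sub_zero]
    have e1 : divergence (fun x : Rn n => β (‖x‖ ^ 2) • x) x =
        divergence (fun y : Rn n => (√(‖y‖ ^ 2))⁻¹ • (y - 0)) x := by
      simp only [divergence, hev.fderiv_eq]
    have hd := hasFDerivAt_inv_norm hx
    have hd' : DifferentiableAt ℝ (fun y : Rn n => y - 0) x := differentiableAt_id.sub_const 0
    rw [e1, divergence_smul hd.differentiableAt hd',
      divergence_sub_const, hd.fderiv, Real.sqrt_sq hx'.le]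
    simp only [sub_zero, smul_apply, innerSL_apply_apply, real_inner_self_eq_norm_sq,
      smul_eq_mul, nsmul_eq_mul]
    field_simp
    push_cast
    ring

theorem norm_fderiv_norm_sub_sq (x₀ x : Rn n) :
    ‖fderiv ℝ (fun x => ‖x - x₀‖ ^ 2) x‖ = 2 * ‖x - x₀‖ := by
  rw [(hasFDerivAt_norm_sub_sq x₀ x).fderiv, ← Nat.cast_smul_eq_nsmul ℝ, norm_smul,
    innerSL_apply_norm]
  simp

theorem fderiv_norm_sub_sq_apply (x₀ x w : Rn n) :
    fderiv ℝ (fun x => ‖x - x₀‖ ^ 2) x w = 2 * inner ℝ (x - x₀) w := by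
  rw [(hasFDerivAt_norm_sub_sq x₀ x).fderiv, smul_apply, innerSL_apply_apply, nsmul_eq_mul]
  norm_cast

theorem inner_unit_radial (y : Rn n) : inner ℝ y (‖y‖⁻¹ • y) = ‖y‖ := by
  rw [inner_smul_right, real_inner_self_eq_norm_sq]
  rcases eq_or_ne ‖y‖ 0 with h | h
  · simp [h]
  · field_simp

/-- Removing a ball of fixed radius increases the perimeter at most by a multiple of the removed
volume. -/
theorem exists_perimeter_diff_ball_le (n : ℕ) {r : ℝ} (hr : 0 < r) :
    ∃ C : ℝ, 0 < C ∧ ∀ (E : Set (Rn n)) (x₀ : Rn n), NullMeasurableSet E → perimeter E ≠ ∞ →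
      perimeter (E \ Metric.closedBall x₀ r) ≤
        perimeter E + ENNReal.ofReal (C * volume.real (E ∩ Metric.closedBall x₀ r)) := by
  -- `[r²/2, 3r²]` contains the calibration strip `r² < |x - x₀|² < 2r²`. The constant is uniform in
  -- `x₀` because only translates of this one field are used.
  obtain ⟨ξ, hξ, hξ1, hξr, -⟩ := exists_radial_field n (a := r ^ 2 / 2) (b := 3 * r ^ 2)
    (by positivity) (by nlinarith)
  obtain ⟨C, hC⟩ := hξ.continuous_divergence.bounded_above_of_compact_support
    hξ.hasCompactSupport_divergence
  have hC0 : 0 ≤ C := (norm_nonneg _).trans (hC 0)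
  refine ⟨C + 1, by positivity, fun E x₀ hE hP => ?_⟩
  have hη : IsTestField fun x => -ξ (x + -x₀) := (hξ.translate (-x₀)).neg
  have h1 := perimeter_inter_superlevel_le (contDiff_norm_sub_sq x₀ (m := 1)) hη
    (fun x => by rw [norm_neg]; exact hξ1 _) (s := r ^ 2) (ε := r ^ 2) (by positivity)
    (fun x hx1 hx2 => by
      rw [norm_fderiv_norm_sub_sq, fderiv_norm_sub_sq_apply, ← sub_eq_add_neg,
        hξr _ (by nlinarith) (by nlinarith), inner_neg_right, inner_unit_radial]
      linarith) hP
  have hle : ∀ x, ‖x - x₀‖ ^ 2 ≤ r ^ 2 ↔ x ∈ Metric.closedBall x₀ r := fun x => by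
    rw [Metric.mem_closedBall, dist_eq_norm, sq_le_sq₀ (norm_nonneg _) hr.le]
  have e1 : E ∩ {x | r ^ 2 < ‖x - x₀‖ ^ 2} = E \ Metric.closedBall x₀ r := by
    ext x
    simp only [mem_inter_iff, Set.mem_sdiff, ← hle, not_le]
    rfl
  have e2 : E ∩ {x | ‖x - x₀‖ ^ 2 ≤ r ^ 2} = E ∩ Metric.closedBall x₀ r := by
    ext x
    simp only [mem_inter_iff, ← hle]
    rfl
  rw [e1, e2] at h1
  refine h1.trans ?_
  rw [← ENNReal.ofReal_toReal hP, ENNReal.toReal_ofReal ENNReal.toReal_nonneg,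
    ← ENNReal.ofReal_add ENNReal.toReal_nonneg (by positivity)]
  refine ENNReal.ofReal_le_ofReal ?_
  have hfin : volume (E ∩ Metric.closedBall x₀ r) < ∞ :=
    (measure_mono inter_subset_right).trans_lt Metric.isBounded_closedBall.measure_lt_top
  have h2 := norm_setIntegral_le_of_norm_le_const (f := divergence fun x => -ξ (x + -x₀)) hfin
    (C := C) (fun x _ => by
      rw [divergence_neg, divergence_translate, norm_neg]; exact hC _)
  rw [Real.norm_eq_abs, abs_le] at h2
  have h3 : 0 ≤ volume.real (E ∩ Metric.closedBall x₀ r) := measureReal_nonneg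
  nlinarith [h2.1]

/-- Intersecting a bounded set with a centered ball decreases the perimeter at least by a multiple
of the removed volume. -/
theorem perimeter_inter_ball_le {E : Set (Rn n)} {r R : ℝ} (hn : 1 ≤ n) (hr : 0 < r)
    (hrR : r ≤ R) (hE : NullMeasurableSet E) (hP : perimeter E ≠ ∞)
    (hER : E ⊆ Metric.closedBall 0 R) :
    perimeter (E ∩ Metric.ball 0 r) + ENNReal.ofReal ((n - 1) / R *
      volume.real (E \ Metric.ball 0 r)) ≤ perimeter E := by
  have hR : 0 < R := hr.trans_le hrR
  -- `[r²/4, 4R²]` covers the strip just inside the sphere of radius `r`, where the calibration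
  -- condition is needed, and the shell `r ≤ |x| ≤ R`, where the divergence is bounded below.
  obtain ⟨ξ, hξ, hξ1, hξr, hξd⟩ := exists_radial_field n (a := r ^ 2 / 4) (b := 4 * R ^ 2)
    (by positivity) (by nlinarith)
  have hf : ContDiff ℝ 1 fun x : Rn n => -‖x - 0‖ ^ 2 := (contDiff_norm_sub_sq 0 (m := 1)).neg
  have hcal : ∀ x : Rn n, -r ^ 2 < -‖x - 0‖ ^ 2 → -‖x - 0‖ ^ 2 < -r ^ 2 + r ^ 2 / 2 →
      fderiv ℝ (fun x : Rn n => -‖x - 0‖ ^ 2) x (ξ x) ≤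
        -‖fderiv ℝ (fun x : Rn n => -‖x - 0‖ ^ 2) x‖ := fun x hx1 hx2 => by
      rw [fderiv_fun_neg, norm_neg, norm_fderiv_norm_sub_sq, neg_apply,
        fderiv_norm_sub_sq_apply]
      simp only [sub_zero] at hx1 hx2 ⊢
      rw [hξr _ (by nlinarith) (by nlinarith), inner_unit_radial]
  have h1 := perimeter_inter_superlevel_le hf hξ hξ1 (by positivity) hcal hP
  -- The zero field shows that the integral of `div ξ` is at most `P(E)`, so `ENNReal.ofReal` in
  -- `h1` truncates nothing.
  have h0 := setIntegral_superlevel_add_le hf hξ hξ1 (by positivity) hcal hP IsTestField.zero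
    (by simp)
  have hlt : ∀ x : Rn n, -r ^ 2 < -‖x - 0‖ ^ 2 ↔ x ∈ Metric.ball (0 : Rn n) r := fun x => by
    rw [mem_ball_zero_iff, sub_zero, neg_lt_neg_iff, sq_lt_sq₀ (norm_nonneg _) hr.le]
  have e1 : E ∩ {x | -r ^ 2 < -‖x - 0‖ ^ 2} = E ∩ Metric.ball 0 r := by
    ext x
    simp only [mem_inter_iff, ← hlt]
    rfl
  have e2 : E ∩ {x | -‖x - 0‖ ^ 2 ≤ -r ^ 2} = E \ Metric.ball 0 r := by
    ext x
    simp only [mem_inter_iff, Set.mem_sdiff, ← hlt, not_lt]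
    rfl
  rw [e1, e2] at h1 h0
  have hle : (n - 1) / R * volume.real (E \ Metric.ball 0 r) ≤
      ∫ x in E \ Metric.ball 0 r, divergence ξ x := by
    have hfin : volume (E \ Metric.ball 0 r) ≠ ∞ :=
      ((measure_mono (sdiff_subset.trans hER)).trans_lt
        Metric.isBounded_closedBall.measure_lt_top).ne
    calc (n - 1) / R * volume.real (E \ Metric.ball 0 r)
        = ∫ _ in E \ Metric.ball 0 r, ((n : ℝ) - 1) / R := by
          rw [setIntegral_const, smul_eq_mul, mul_comm]
      _ ≤ ∫ x in E \ Metric.ball 0 r, divergence ξ x := by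
          have hm : NullMeasurableSet (E \ Metric.ball 0 r) :=
            hE.diff Metric.isOpen_ball.measurableSet.nullMeasurableSet
          refine integral_mono_ae (integrableOn_const hfin)
            hξ.integrable_divergence.integrableOn ?_
          refine (ae_restrict_iff'₀ hm).2 (ae_of_all _ fun x hx => ?_)
          have hx1 : r ≤ ‖x‖ := by simpa using hx.2
          have hx2 : ‖x‖ ≤ R := by simpa using hER hx.1
          rw [hξd x (by nlinarith) (by nlinarith)]
          have hn' : (1 : ℝ) ≤ n := by exact_mod_cast hn
          have : 0 < ‖x‖ := hr.trans_le hx1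
          exact div_le_div_of_nonneg_left (by linarith) this hx2
  have hz : ∫ x in E ∩ Metric.ball 0 r, divergence (fun _ : Rn n => (0 : Rn n)) x = 0 := by
    simp [divergence]
  rw [hz] at h0
  calc _ ≤ ENNReal.ofReal ((perimeter E).toReal - ∫ x in E \ Metric.ball 0 r, divergence ξ x) +
        ENNReal.ofReal (∫ x in E \ Metric.ball 0 r, divergence ξ x) := by gcongr
    _ = perimeter E := by
        have hn' : (1 : ℝ) ≤ n := by exact_mod_cast hn
        have hV : 0 ≤ volume.real (E \ Metric.ball 0 r) := measureReal_nonneg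
        have : 0 ≤ (n - 1) / R * volume.real (E \ Metric.ball 0 r) :=
          mul_nonneg (div_nonneg (by linarith) hR.le) hV
        rw [← ENNReal.ofReal_add (by linarith) (by linarith), sub_add_cancel,
          ENNReal.ofReal_toReal hP]

end Radial

/-! ### Outward minimizing sets: null-set invariance and finite perimeter -/

section FinitePerimeter

variable {n : ℕ}

/-- `(F ∩ Ω) ∪ E` is equivalent to `F` and satisfies the inclusions everywhere. -/
theorem IsOutwardMinimizing.perimeter_le {Ω E F : Set (Rn n)} (h : IsOutwardMinimizing Ω E)
    (hF : NullMeasurableSet F) (hEF : ∀ᵐ x, x ∈ E → x ∈ F) (hFΩ : ∀ᵐ x, x ∈ F → x ∈ Ω) :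
    perimeter E ≤ perimeter F := by
  have he : (F ∩ Ω ∪ E : Set (Rn n)) =ᵐ[volume] F := by
    filter_upwards [hEF, hFΩ] with x h1 h2
    refine propext ⟨?_, fun hx => Or.inl ⟨hx, h2 hx⟩⟩
    rintro (hx | hx)
    · exact hx.1
    · exact h1 hx
  rw [← perimeter_congr he]
  exact h.2.2 _ (hF.congr he.symm) subset_union_right (union_subset inter_subset_right h.2.1)

/-- The superlevel sets of a `C¹` cutoff, for levels in `[0, 1)`, are admissible competitors.
Integrating over the level bounds `P(E)` by the `L¹` norm of the cutoff's derivative. -/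
theorem IsOutwardMinimizing.perimeter_ne_top {Ω E : Set (Rn n)} (h : IsOutwardMinimizing Ω E)
    (hcpt : IsCompact (closure E)) (hsub : closure E ⊆ interior Ω) : perimeter E ≠ ∞ := by
  obtain ⟨δ, hδ, hδΩ⟩ := hcpt.exists_thickening_subset_open isOpen_interior hsub
  obtain ⟨f, hf1, hf0, -⟩ := exists_contMDiffMap_one_nhds_of_subset_interior
    (modelWithCornersSelf ℝ (Rn n)) (n := 1) (isClosed_closure (s := E))
    (t := Metric.thickening δ (closure E))
    (by rw [Metric.isOpen_thickening.interior_eq]; exact Metric.self_subset_thickening hδ _)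
  have hf : ContDiff ℝ 1 f := f.contMDiff.contDiff
  have hs : HasCompactSupport f := by
    obtain ⟨R, hR⟩ := (hcpt.isBounded.thickening (δ := δ)).subset_closedBall (0 : Rn n)
    exact HasCompactSupport.intro (isCompact_closedBall (0 : Rn n) R)
      fun x hx => hf0 x fun hx' => hx (hR hx')
  have hle : ∀ t : ℝ, 0 ≤ t → t < 1 → perimeter E ≤ perimeter {x | t < f x} := fun t h0 h1 => by
    refine h.2.2 _ (isOpen_lt continuous_const hf.continuous).measurableSet.nullMeasurableSet
      (fun x hx => ?_) (fun x hx => ?_)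
    · have : f x = 1 := hf1.self_of_nhdsSet x (subset_closure hx)
      change t < f x
      rwa [this]
    · have hx' : t < f x := hx
      by_contra hxΩ
      rw [hf0 x fun hx'' => hxΩ (interior_subset (hδΩ hx''))] at hx'
      linarith
  have h1 := sum_le_lintegral (N := 1) one_pos (a := fun _ => perimeter E)
    (g := fun t => perimeter {x | t < f x}) (by
      intro j hj t h0 h1
      obtain rfl : j = 0 := by omega
      exact hle t (by simpa using h0) (by simpa using h1))
  have h2 : perimeter E ≤ ∫⁻ x, ‖fderiv ℝ f x‖ₑ := by
    have := (h1.trans (lintegral_perimeter_le hf.continuous.locallyIntegrable)).trans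
      (totalVariation_le_lintegral_enorm_fderiv hf)
    simpa using this
  have h3 : Integrable (fderiv ℝ f) := (hf.continuous_fderiv (by norm_num)).integrable_of_hasCompactSupport
    (hs.fderiv ℝ)
  exact (h2.trans_lt h3.2).ne

end FinitePerimeter

/-! ### One step: confinement, inheritance and nesting -/

section Minimizers

variable {n : ℕ} {h : ℝ} {E G : Set (Rn n)}

/-- `G` minimizes the step functional `F_h(·, E)`. -/
def IsStepMinimizer (h : ℝ) (G E : Set (Rn n)) : Prop :=
  NullMeasurableSet G ∧ ∀ F : Set (Rn n), NullMeasurableSet F →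
    stepFunctional h G E ≤ stepFunctional h F E

/-- The dissipation `(1/h) ∫_T d_E` of a set `T`. -/
noncomputable def dissipation (h : ℝ) (E T : Set (Rn n)) : ℝ≥0∞ :=
  ENNReal.ofReal (1 / h) * ∫⁻ x in T, Metric.infEDist x (frontier E)

theorem dissipation_mono {S T : Set (Rn n)} (hST : S ⊆ T) :
    dissipation h E S ≤ dissipation h E T :=
  mul_le_mul_right (lintegral_mono_set hST) _

theorem dissipation_union_le (S T : Set (Rn n)) :
    dissipation h E (S ∪ T) ≤ dissipation h E S + dissipation h E T := by
  unfold dissipation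
  rw [← mul_add]
  exact mul_le_mul_right (lintegral_union_le _ _ _) _

theorem dissipation_union {S T : Set (Rn n)} (hd : Disjoint S T) (hT : NullMeasurableSet T) :
    dissipation h E (S ∪ T) = dissipation h E S + dissipation h E T := by
  unfold dissipation
  rw [← mul_add, Measure.restrict_union₀ hd.aedisjoint hT, lintegral_add_measure]

theorem dissipation_le (hh : 0 < h) {T : Set (Rn n)} (hT : NullMeasurableSet T)
    (hTv : volume T ≠ ∞) {c : ℝ} (hc : 0 ≤ c)
    (hd : ∀ x ∈ T, Metric.infEDist x (frontier E) ≤ ENNReal.ofReal c) :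
    dissipation h E T ≤ ENNReal.ofReal (c / h * volume.real T) := by
  have h1 : ∫⁻ x in T, Metric.infEDist x (frontier E) ≤ ENNReal.ofReal c * volume T := by
    rw [← setLIntegral_const]
    refine lintegral_mono_ae ?_
    exact (ae_restrict_iff'₀ hT).2 (ae_of_all _ hd)
  calc dissipation h E T ≤ ENNReal.ofReal (1 / h) * (ENNReal.ofReal c * volume T) :=
        mul_le_mul_right h1 _
    _ = ENNReal.ofReal (c / h * volume.real T) := by
        rw [ENNReal.ofReal_mul (by positivity), measureReal_def, ENNReal.ofReal_toReal hTv,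
          ← mul_assoc, ← ENNReal.ofReal_mul (by positivity)]
        congr 2; ring

theorem le_dissipation (hh : 0 < h) {T : Set (Rn n)} (hT : NullMeasurableSet T)
    (hTv : volume T ≠ ∞) {c : ℝ} (hc : 0 ≤ c)
    (hd : ∀ x ∈ T, ENNReal.ofReal c ≤ Metric.infEDist x (frontier E)) :
    ENNReal.ofReal (c / h * volume.real T) ≤ dissipation h E T := by
  have h1 : ENNReal.ofReal c * volume T ≤ ∫⁻ x in T, Metric.infEDist x (frontier E) := by
    rw [← setLIntegral_const]
    refine lintegral_mono_ae ?_
    exact (ae_restrict_iff'₀ hT).2 (ae_of_all _ hd)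
  calc ENNReal.ofReal (c / h * volume.real T)
      = ENNReal.ofReal (1 / h) * (ENNReal.ofReal c * volume T) := by
        rw [ENNReal.ofReal_mul (by positivity), measureReal_def, ENNReal.ofReal_toReal hTv,
          ← mul_assoc, ← ENNReal.ofReal_mul (by positivity)]
        congr 2; ring
    _ ≤ dissipation h E T := mul_le_mul_right h1 _

theorem IsStepMinimizer.stepFunctional_le (hG : IsStepMinimizer h G E) (hE : NullMeasurableSet E) :
    stepFunctional h G E ≤ perimeter E := by
  have := hG.2 E hE
  simpa [stepFunctional] using this

theorem IsStepMinimizer.perimeter_le (hG : IsStepMinimizer h G E) (hE : NullMeasurableSet E) :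
    perimeter G ≤ perimeter E :=
  le_self_add.trans (hG.stepFunctional_le hE)

/-- Needed to cancel dissipation in the comparisons, since `d_E` may take the value `+∞`. -/
theorem IsStepMinimizer.dissipation_ne_top (hG : IsStepMinimizer h G E)
    (hE : NullMeasurableSet E) (hP : perimeter E ≠ ∞) :
    dissipation h E (symmDiff G E) ≠ ∞ :=
  ((le_add_self.trans (hG.stepFunctional_le hE)).trans_lt hP.lt_top).ne

/-- Comparison with a competitor whose symmetric difference is not much larger. -/
theorem IsStepMinimizer.perimeter_le_add (hG : IsStepMinimizer h G E) (hE : NullMeasurableSet E)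
    (hP : perimeter E ≠ ∞) {F T : Set (Rn n)} (hF : NullMeasurableSet F)
    (hFT : symmDiff F E ⊆ symmDiff G E ∪ T) :
    perimeter G ≤ perimeter F + dissipation h E T := by
  refine (ENNReal.add_le_add_iff_right (hG.dissipation_ne_top hE hP)).1 ?_
  calc perimeter G + dissipation h E (symmDiff G E) ≤
        perimeter F + dissipation h E (symmDiff F E) := hG.2 F hF
    _ ≤ perimeter F + (dissipation h E (symmDiff G E) + dissipation h E T) :=
        add_le_add le_rfl ((dissipation_mono hFT).trans (dissipation_union_le _ _))
    _ = _ := by ring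

/-- Comparison with a competitor whose symmetric difference is smaller by `T`. -/
theorem IsStepMinimizer.perimeter_add_le (hG : IsStepMinimizer h G E) (hE : NullMeasurableSet E)
    (hP : perimeter E ≠ ∞) {F T : Set (Rn n)} (hF : NullMeasurableSet F) (hT : NullMeasurableSet T)
    (hd : Disjoint (symmDiff F E) T) (hFT : symmDiff F E ∪ T ⊆ symmDiff G E) :
    perimeter G + dissipation h E T ≤ perimeter F := by
  have hfin : dissipation h E (symmDiff F E) ≠ ∞ :=
    ((dissipation_mono (subset_union_left.trans hFT)).trans_lt
      (hG.dissipation_ne_top hE hP).lt_top).ne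
  refine (ENNReal.add_le_add_iff_right hfin).1 ?_
  calc perimeter G + dissipation h E T + dissipation h E (symmDiff F E)
      = perimeter G + dissipation h E (symmDiff F E ∪ T) := by
        rw [dissipation_union hd hT]; ring
    _ ≤ perimeter G + dissipation h E (symmDiff G E) := add_le_add le_rfl (dissipation_mono hFT)
    _ ≤ perimeter F + dissipation h E (symmDiff F E) := hG.2 F hF

/-- For small time steps a minimizer does not leave a neighborhood of the previous set. -/
theorem IsStepMinimizer.ae_mem_thickening (hG : IsStepMinimizer h G E) (hE : NullMeasurableSet E)
    (hP : perimeter E ≠ ∞) (hh : 0 < h) {K : Set (Rn n)} (hEK : closure E ⊆ K) {δ : ℝ} (hδ : 0 < δ)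
    {C : ℝ} (hC : ∀ (E : Set (Rn n)) (x₀ : Rn n), NullMeasurableSet E → perimeter E ≠ ∞ →
      perimeter (E \ Metric.closedBall x₀ (δ / 2)) ≤
        perimeter E + ENNReal.ofReal (C * volume.real (E ∩ Metric.closedBall x₀ (δ / 2))))
    (hhC : h * C < δ / 2) : ∀ᵐ x, x ∈ G → x ∈ Metric.thickening δ K := by
  have hPG : perimeter G ≠ ∞ := ((hG.perimeter_le hE).trans_lt hP.lt_top).ne
  have hloc : ∀ x₀ ∉ Metric.thickening δ K, volume (G ∩ Metric.closedBall x₀ (δ / 2)) = 0 := by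
    intro x₀ hx₀
    set B := Metric.closedBall x₀ (δ / 2) with hB
    have hBm : NullMeasurableSet B := Metric.isClosed_closedBall.measurableSet.nullMeasurableSet
    have hfar : ∀ x ∈ B, ∀ y ∈ K, δ / 2 ≤ dist x y := fun x hx y hy => by
      have h1 : δ ≤ dist x₀ y := by
        by_contra hlt
        exact hx₀ (Metric.mem_thickening_iff.2 ⟨y, hy, not_le.1 hlt⟩)
      have h2 := dist_triangle x₀ x y
      rw [hB, Metric.mem_closedBall, dist_comm] at hx
      linarith
    have hBE : ∀ x ∈ B, x ∉ E := fun x hx hxE => by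
      have := hfar x hx x (hEK (subset_closure hxE))
      rw [dist_self] at this
      linarith
    have hfin : volume (G ∩ B) ≠ ∞ :=
      ((measure_mono inter_subset_right).trans_lt Metric.isBounded_closedBall.measure_lt_top).ne
    -- Deleting `B`, which is disjoint from `E`, saves dissipation at least `δ/(2h)` per unit volume
    -- and costs perimeter at most `C` per unit volume.
    have h1 := hG.perimeter_add_le hE hP (F := G \ B) (T := G ∩ B) (hG.1.diff hBm)
      (hG.1.inter hBm)
      (by
        rw [Set.disjoint_left]
        rintro x (⟨⟨-, hx⟩, -⟩ | ⟨hx, -⟩) ⟨-, hx'⟩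
        · exact hx hx'
        · exact hBE x hx' hx)
      (by
        rintro x ((⟨⟨hx, -⟩, hx'⟩ | ⟨hx, hx'⟩) | ⟨hx, hx'⟩)
        · exact Or.inl ⟨hx, hx'⟩
        · exact Or.inr ⟨hx, fun hxG => hx' ⟨hxG, fun hxB => hBE x hxB hx⟩⟩
        · exact Or.inl ⟨hx, hBE x hx'⟩)
    have h2 := le_dissipation (E := E) hh (hG.1.inter hBm) hfin (c := δ / 2) (by positivity)
      (fun x hx => by
        rw [Metric.le_infEDist]
        intro y hy
        rw [edist_dist]
        exact ENNReal.ofReal_le_ofReal (hfar x hx.2 y (hEK (frontier_subset_closure hy))))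
    have h3 : ENNReal.ofReal (δ / 2 / h * volume.real (G ∩ B)) ≤
        ENNReal.ofReal (C * volume.real (G ∩ B)) := by
      refine h2.trans ((ENNReal.add_le_add_iff_left hPG).1 (h1.trans ?_))
      exact hC G x₀ hG.1 hPG
    by_contra hne
    have hpos : 0 < volume.real (G ∩ B) := ENNReal.toReal_pos hne hfin
    have h4 : C < δ / 2 / h := by rw [lt_div_iff₀ hh]; linarith
    have h5 := (ENNReal.ofReal_lt_ofReal_iff (by positivity)).2 (mul_lt_mul_of_pos_right h4 hpos)
    exact absurd h3 (not_le.2 h5)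
  have h0 : volume (G \ Metric.thickening δ K) = 0 := by
    refine measure_null_of_locally_null _ fun x hx => ⟨(G \ Metric.thickening δ K) ∩
      Metric.closedBall x (δ / 2), ?_, ?_⟩
    · exact inter_mem self_mem_nhdsWithin
        (mem_nhdsWithin_of_mem_nhds (Metric.closedBall_mem_nhds x (by positivity)))
    · exact measure_mono_null (inter_subset_inter_left _ sdiff_subset) (hloc x hx.2)
  filter_upwards [measure_eq_zero_iff_ae_notMem.1 h0] with x hx hxG
  by_contra hx'
  exact hx ⟨hxG, hx'⟩

/-- Submodularity, with `P(E) ≤ P(G ∪ E)` and the finite number `P(E)` cancelled. -/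
theorem IsOutwardMinimizing.perimeter_inter_le {Ω : Set (Rn n)} (hE : IsOutwardMinimizing Ω E)
    (hP : perimeter E ≠ ∞) (hG : NullMeasurableSet G) (hGΩ : ∀ᵐ x, x ∈ G → x ∈ Ω) :
    perimeter (G ∩ E) ≤ perimeter G := by
  have h2 : perimeter E ≤ perimeter (G ∪ E) :=
    hE.perimeter_le (hG.union hE.1) (ae_of_all _ fun x hx => Or.inr hx)
      (hGΩ.mono fun x hx hx' => hx'.elim hx fun h => hE.2.1 h)
  refine (ENNReal.add_le_add_iff_left hP).1 ?_
  calc perimeter E + perimeter (G ∩ E) ≤ perimeter (G ∪ E) + perimeter (G ∩ E) :=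
        add_le_add h2 le_rfl
    _ ≤ perimeter G + perimeter E := perimeter_union_add_perimeter_inter_le hG hE.1
    _ = _ := add_comm _ _

/-- Outside the previous outward minimizing set a minimizer lives on its topological boundary. -/
theorem IsStepMinimizer.ae_mem_frontier (hG : IsStepMinimizer h G E) (hh : 0 < h)
    (hE : NullMeasurableSet E) (hP : perimeter E ≠ ∞)
    (hGE : perimeter (G ∩ E) ≤ perimeter G) :
    ∀ᵐ x, x ∈ G → x ∉ E → x ∈ frontier E := by
  have hPG : perimeter G ≠ ∞ := ((hG.perimeter_le hE).trans_lt hP.lt_top).ne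
  have hm : NullMeasurableSet (G \ E) := hG.1.diff hE
  -- Passing to `G ∩ E` saves the whole dissipation of `G \ E` and does not raise the perimeter, so
  -- that dissipation is zero.
  have h1 := hG.perimeter_add_le hE hP (F := G ∩ E) (T := G \ E) (hG.1.inter hE)
    hm (by
      rw [Set.disjoint_left]
      rintro x (⟨⟨-, hx⟩, hx'⟩ | ⟨hx, -⟩) ⟨-, hx''⟩
      · exact hx' hx
      · exact hx'' hx)
    (by
      rintro x ((⟨⟨-, hx⟩, hx'⟩ | ⟨hx, hx'⟩) | ⟨hx, hx'⟩)
      · exact absurd hx hx'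
      · exact Or.inr ⟨hx, fun hxG => hx' ⟨hxG, hx⟩⟩
      · exact Or.inl ⟨hx, hx'⟩)
  have h4 : dissipation h E (G \ E) = 0 := by
    have := (ENNReal.add_le_add_iff_left hPG).1 ((h1.trans hGE).trans (add_zero _).ge)
    exact nonpos_iff_eq_zero.1 this
  have h5 : ∫⁻ x in G \ E, Metric.infEDist x (frontier E) = 0 := by
    rcases mul_eq_zero.1 h4 with h | h
    · rw [ENNReal.ofReal_eq_zero] at h
      exact absurd h (not_le.2 (by positivity))
    · exact h
  rw [lintegral_eq_zero_iff' Metric.continuous_infEDist.measurable.aemeasurable] at h5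
  have h6 := (ae_restrict_iff'₀ hm).1 h5
  filter_upwards [h6] with x hx hxG hxE
  have h7 := Metric.mem_closure_iff_infEDist_zero.2 (hx ⟨hxG, hxE⟩)
  rwa [isClosed_frontier.closure_eq] at h7

/-- A minimizer inherits the outward minimizing property. -/
theorem IsStepMinimizer.isOutwardMinimizing (hG : IsStepMinimizer h G E)
    {Ω : Set (Rn n)} (hE : IsOutwardMinimizing Ω E) (hP : perimeter E ≠ ∞) (hGΩ : G ⊆ Ω) :
    IsOutwardMinimizing Ω G := by
  refine ⟨hG.1, hGΩ, fun F hF hGF hFΩ => ?_⟩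
  -- `(F ∩ E) Δ E = E \ F` is part of `E \ G`, so there is no extra dissipation; this does not use
  -- `G ⊆ E`.
  have h1 := hG.perimeter_le_add hE.1 hP (F := F ∩ E) (T := ∅) (hF.inter hE.1) (by
    rintro x (⟨⟨-, hx⟩, hx'⟩ | ⟨hx, hx'⟩)
    · exact absurd hx hx'
    · exact Or.inl (Or.inr ⟨hx, fun hxG => hx' ⟨hGF hxG, hx⟩⟩))
  have h2 : dissipation h E ∅ = 0 := by simp [dissipation]
  rw [h2, add_zero] at h1
  refine h1.trans ((ENNReal.add_le_add_iff_left hP).1 ?_)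
  calc perimeter E + perimeter (F ∩ E) ≤ perimeter (F ∪ E) + perimeter (F ∩ E) :=
        add_le_add (hE.2.2 _ (hF.union hE.1) subset_union_right (union_subset hFΩ hE.2.1)) le_rfl
    _ ≤ perimeter F + perimeter E := perimeter_union_add_perimeter_inter_le hF hE.1
    _ = _ := add_comm _ _

/-- At a point of full density of `S`, any disjoint set has small density. -/
theorem eventually_volume_inter_ball_le {S K : Set (Rn n)} (hS : NullMeasurableSet S)
    (hd : Disjoint S K) {x : Rn n} (hn : 1 ≤ n) {ε : ℝ} (hε : 0 < ε)
    (h : Tendsto (fun r => volume (S ∩ Metric.closedBall x r) / volume (Metric.closedBall x r))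
      (𝓝[>] 0) (𝓝 1)) :
    ∀ᶠ r in 𝓝[>] (0 : ℝ), volume.real (K ∩ Metric.ball x r) ≤ ε * r ^ n := by
  have : NeZero n := ⟨by omega⟩
  have : Nontrivial (Rn n) := inferInstance
  set ω := volume.real (Metric.ball (0 : Rn n) 1) with hω
  have hω0 : 0 ≤ ω := measureReal_nonneg
  have hη : 0 < ε / (ω + 1) := by positivity
  have hvol : ∀ r : ℝ, 0 < r → volume.real (Metric.closedBall x r) = r ^ n * ω := fun r hr => by
    rw [measureReal_def, Measure.addHaar_closedBall _ _ hr.le, ENNReal.toReal_mul,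
      ENNReal.toReal_ofReal (by positivity)]
    simp [hω, measureReal_def]
  have h1 : Tendsto (fun r => (volume (S ∩ Metric.closedBall x r) /
      volume (Metric.closedBall x r)).toReal) (𝓝[>] 0) (𝓝 1) := by
    exact (ENNReal.tendsto_toReal ENNReal.one_ne_top).comp h
  filter_upwards [h1.eventually (Ioi_mem_nhds (show 1 - ε / (ω + 1) < 1 by linarith)),
    self_mem_nhdsWithin] with r hr hr0
  have hr0 : 0 < r := hr0
  have hb : volume (Metric.closedBall x r) ≠ ∞ := Metric.isBounded_closedBall.measure_lt_top.ne
  have hr' : 1 - ε / (ω + 1) < volume.real (S ∩ Metric.closedBall x r) /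
      volume.real (Metric.closedBall x r) := by
    rw [measureReal_def, measureReal_def, ← ENNReal.toReal_div]
    exact hr
  have hpos : 0 < volume.real (Metric.closedBall x r) :=
    ENNReal.toReal_pos (Metric.measure_closedBall_pos _ _ hr0).ne' hb
  rw [lt_div_iff₀ hpos] at hr'
  have h2 : volume.real (K ∩ Metric.closedBall x r) + volume.real (S ∩ Metric.closedBall x r) ≤
      volume.real (Metric.closedBall x r) := by
    have hm := hS.inter (Metric.isClosed_closedBall (x := x) (ε := r)).measurableSet.nullMeasurableSet
    have hdis : Disjoint (K ∩ Metric.closedBall x r) (S ∩ Metric.closedBall x r) :=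
      hd.symm.mono inter_subset_left inter_subset_left
    have hfin : ∀ A : Set (Rn n), volume (A ∩ Metric.closedBall x r) ≠ ∞ := fun A =>
      ((measure_mono inter_subset_right).trans_lt hb.lt_top).ne
    simp only [measureReal_def]
    rw [← ENNReal.toReal_add (hfin K) (hfin S)]
    refine ENNReal.toReal_mono hb ?_
    rw [← measure_union₀ hm hdis.aedisjoint]
    exact measure_mono (union_subset inter_subset_right inter_subset_right)
  have h3 : volume.real (K ∩ Metric.ball x r) ≤ volume.real (K ∩ Metric.closedBall x r) :=
    measureReal_mono (inter_subset_inter_right _ Metric.ball_subset_closedBall)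
      ((measure_mono inter_subset_right).trans_lt hb.lt_top).ne
  rw [hvol r hr0] at hr' h2
  calc volume.real (K ∩ Metric.ball x r) ≤ ε / (ω + 1) * (r ^ n * ω) := by linarith
    _ = ε * r ^ n * (ω / (ω + 1)) := by field_simp
    _ ≤ ε * r ^ n * 1 := by
        gcongr
        rw [div_le_one (by positivity)]
        linarith
    _ = _ := mul_one _

/-- A minimizer is contained in the previous normalized outward minimizing set. -/
theorem IsStepMinimizer.ae_subset (hn : 2 ≤ n) (hG : IsStepMinimizer h G E) (hh : 0 < h)
    (hE : NullMeasurableSet E) (hN : IsNormalized E) (hP : perimeter E ≠ ∞)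
    (hfr : ∀ᵐ x, x ∈ G → x ∉ E → x ∈ frontier E) (hKG : perimeter (G ∩ E) ≤ perimeter G) :
    ∀ᵐ x, x ∈ G → x ∈ E := by
  obtain ⟨ε, hε, hdens⟩ := exists_density_const hn
  have hPG : perimeter G ≠ ∞ := ((hG.perimeter_le hE).trans_lt hP.lt_top).ne
  have hS : NullMeasurableSet (G \ E) := hG.1.diff hE
  -- At a point of full density of `G \ E`, the sets `G ∩ E` and `Gᶜ` both have density zero.
  have hleb := (ae_restrict_iff'₀ hS).1
    (Besicovitch.ae_tendsto_measure_inter_div (volume : Measure (Rn n)) (G \ E))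
  filter_upwards [hfr, hleb] with x hx1 hx2 hxG
  by_contra hxE
  have hxf := hx1 hxG hxE
  have hlim := hx2 ⟨hxG, hxE⟩
  have ev1 := eventually_volume_inter_ball_le (K := G ∩ E) hS
    (Set.disjoint_left.2 fun y hy hy' => hy.2 hy'.2) (by omega) hε hlim
  have ev2 := eventually_volume_inter_ball_le (K := Gᶜ) hS
    (Set.disjoint_left.2 fun y hy hy' => hy' hy.1) (by omega) hε hlim
  -- `d_E ≤ R` in the ball, because its center lies on `∂E`. Almost minimality thus holds with `Λ =
  -- R/h`, and `R < √h` gives `ΛR ≤ 1`.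
  have ev3 : ∀ᶠ r in 𝓝[>] (0 : ℝ), r < √h :=
    mem_nhdsWithin_of_mem_nhds (Iio_mem_nhds (Real.sqrt_pos.2 hh))
  obtain ⟨R, ⟨⟨hR1, hR2⟩, hR3⟩, hR0⟩ :=
    (((ev1.and ev2).and ev3).and (self_mem_nhdsWithin (s := Ioi (0 : ℝ)))).exists
  have hR0 : 0 < R := hR0
  have hRh : R / h * R ≤ 1 := by
    rw [div_mul_eq_mul_div, div_le_one hh, ← Real.sq_sqrt hh.le]
    nlinarith [Real.sqrt_nonneg h]
  have hdR : ∀ y ∈ Metric.ball x R, Metric.infEDist y (frontier E) ≤ ENNReal.ofReal R :=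
    fun y hy => by
      refine (Metric.infEDist_le_edist_of_mem hxf).trans ?_
      rw [edist_dist]
      exact ENNReal.ofReal_le_ofReal (Metric.mem_ball.1 hy).le
  have hdiss : ∀ T : Set (Rn n), NullMeasurableSet T → T ⊆ Metric.ball x R →
      dissipation h E T ≤ ENNReal.ofReal (R / h * volume.real T) := fun T hT hTR =>
    dissipation_le hh hT ((measure_mono hTR).trans_lt Metric.isBounded_ball.measure_lt_top).ne
      hR0.le fun y hy => hdR y (hTR hy)
  have z1 := hdens (G ∩ E) x R (R / h) (hG.1.inter hE)
    (hKG.trans_lt hPG.lt_top).ne hR0 (by positivity) hRh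
    (fun A hA hAR => by
      have hAm := hA.measurableSet.nullMeasurableSet (μ := (volume : Measure (Rn n)))
      refine hKG.trans ((hG.perimeter_le_add hE hP (F := (G ∩ E) \ A) (T := (G ∩ E) ∩ A)
        ((hG.1.inter hE).diff hAm) ?_).trans
        (add_le_add le_rfl (hdiss _ ((hG.1.inter hE).inter hAm) (inter_subset_right.trans hAR))))
      rintro y (⟨⟨⟨-, hy⟩, -⟩, hy'⟩ | ⟨hy, hy'⟩)
      · exact absurd hy hy'
      · by_cases hyG : y ∈ G
        · refine Or.inr ⟨⟨hyG, hy⟩, ?_⟩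
          by_contra hyA
          exact hy' ⟨⟨hyG, hy⟩, hyA⟩
        · exact Or.inl (Or.inr ⟨hy, hyG⟩)) hR1
  -- Deleting `A` from the complement amounts to adding `A` to `G`.
  have z2 := hdens Gᶜ x R (R / h) hG.1.compl (by rwa [perimeter_compl hG.1]) hR0 (by positivity) hRh
    (fun A hA hAR => by
      have hAm := hA.measurableSet.nullMeasurableSet (μ := (volume : Measure (Rn n)))
      have e : perimeter (Gᶜ \ A) = perimeter (G ∪ A) := by
        rw [← perimeter_compl (hG.1.union hAm), compl_union, Set.sdiff_eq]
      rw [perimeter_compl hG.1, e]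
      refine (hG.perimeter_le_add hE hP (T := Gᶜ ∩ A) (hG.1.union hAm) ?_).trans
        (add_le_add le_rfl (hdiss _ (hG.1.compl.inter hAm) (inter_subset_right.trans hAR)))
      rintro y (⟨hy | hy, hy'⟩ | ⟨hy, hy'⟩)
      · exact Or.inl (Or.inl ⟨hy, hy'⟩)
      · by_cases hyG : y ∈ G
        · exact Or.inl (Or.inl ⟨hyG, hy'⟩)
        · exact Or.inr ⟨hyG, hy⟩
      · exact Or.inl (Or.inr ⟨hy, fun hyG => hy' (Or.inl hyG)⟩)) hR2
  -- `E` is covered by `G ∩ E` and `Gᶜ`, both null near `x`.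
  have hz : volume (E ∩ Metric.ball x (R / 2)) = 0 := by
    refine measure_mono_null ?_ (measure_union_null z1 z2)
    intro y hy
    by_cases hyG : y ∈ G
    · exact Or.inl ⟨⟨hyG, hy.1⟩, hy.2⟩
    · exact Or.inr ⟨hyG, hy.2⟩
  exact hN.notMem_closure hE Metric.isOpen_ball hz (Metric.mem_ball_self (by positivity))
    (frontier_subset_closure hxf)

end Minimizers

/-! ### Shrinking of enclosing balls -/

section Extinction

variable {n : ℕ} {h : ℝ} {E G : Set (Rn n)}

/-- A segment missing the frontier would be disconnected by `interior E` and the complement of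
`closure E`. -/
theorem exists_mem_segment_frontier {x y : Rn n} (hx : x ∈ E) (hy : y ∉ E) :
    ∃ z ∈ segment ℝ x y, z ∈ frontier E := by
  by_contra! hcon
  have hsub : segment ℝ x y ⊆ interior E ∪ (closure E)ᶜ := fun z hz => by
    by_cases hzc : z ∈ closure E
    · refine Or.inl ?_
      by_contra hzi
      exact hcon z hz ⟨hzc, hzi⟩
    · exact Or.inr hzc
  have hxs := left_mem_segment ℝ x y
  have hys := right_mem_segment ℝ x y
  obtain ⟨z, -, hz1, hz2⟩ := (convex_segment x y).isPreconnected _ _ isOpen_interior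
    isClosed_closure.isOpen_compl hsub
    ⟨x, hxs, (hsub hxs).resolve_right fun h => h (subset_closure hx)⟩
    ⟨y, hys, (hsub hys).resolve_left fun h => hy (interior_subset h)⟩
  exact hz2 (subset_closure (interior_subset hz1))

/-- The outward radial segment from `x` to radius `r + 2c` leaves `E`, so it meets the frontier; its
length is at most `2c`. -/
theorem infEDist_frontier_le {r c : ℝ} (hr : 0 < r) (hc : 0 < c)
    (hEr : E ⊆ Metric.closedBall 0 (r + c)) {x : Rn n} (hx : x ∈ E) (hxr : r ≤ ‖x‖) :
    Metric.infEDist x (frontier E) ≤ ENNReal.ofReal (2 * c) := by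
  have hx0 : 0 < ‖x‖ := hr.trans_le hxr
  have hxc : ‖x‖ ≤ r + c := by simpa using hEr hx
  let y : Rn n := ((r + 2 * c) / ‖x‖) • x
  have hy : ‖y‖ = r + 2 * c := by
    simp only [y]
    rw [norm_smul, Real.norm_of_nonneg (by positivity), div_mul_cancel₀ _ hx0.ne']
  have hyE : y ∉ E := fun h => by
    have := hEr h
    rw [mem_closedBall_zero_iff, hy] at this
    linarith
  obtain ⟨z, hz, hzf⟩ := exists_mem_segment_frontier hx hyE
  refine (Metric.infEDist_le_edist_of_mem hzf).trans ?_
  rw [edist_dist]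
  refine ENNReal.ofReal_le_ofReal ?_
  have h1 : dist x z ≤ dist x y := by
    obtain ⟨θ, ⟨h0, h1⟩, rfl⟩ := (segment_eq_image_lineMap ℝ x y) ▸ hz
    rw [dist_left_lineMap, Real.norm_of_nonneg h0]
    exact mul_le_of_le_one_left dist_nonneg h1
  refine h1.trans ?_
  have h2 : x - y = (1 - (r + 2 * c) / ‖x‖) • x := by simp only [y, sub_smul, one_smul]
  rw [dist_eq_norm, h2, norm_smul, ← norm_norm x, ← norm_mul, norm_norm, sub_mul, one_mul,
    div_mul_cancel₀ _ hx0.ne', Real.norm_eq_abs, abs_le]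
  constructor <;> linarith

/-- The radius of a ball containing the evolving set decreases at a definite rate. -/
theorem IsStepMinimizer.subset_closedBall (hn : 1 ≤ n) (hG : IsStepMinimizer h G E) (hh : 0 < h)
    (hE : NullMeasurableSet E) (hP : perimeter E ≠ ∞) (hN : IsNormalized G) {R r c : ℝ}
    (hr : 0 < r) (hrR : r ≤ R) (hc : 0 < c) (hcR : 2 * c / h < (n - 1) / R)
    (hER : E ⊆ Metric.closedBall 0 (r + c)) (hGR : G ⊆ Metric.closedBall 0 R) :
    G ⊆ Metric.closedBall 0 r := by
  have hPG : perimeter G ≠ ∞ := ((hG.perimeter_le hE).trans_lt hP.lt_top).ne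
  have hBm : NullMeasurableSet (Metric.ball (0 : Rn n) r) (volume : Measure (Rn n)) :=
    Metric.isOpen_ball.measurableSet.nullMeasurableSet
  have hfin : volume (G \ Metric.ball 0 r) ≠ ∞ :=
    ((measure_mono (sdiff_subset.trans hGR)).trans_lt Metric.isBounded_closedBall.measure_lt_top).ne
  have hfin' : volume ((G ∩ E) \ Metric.ball 0 r) ≠ ∞ :=
    ((measure_mono (sdiff_subset_sdiff_left inter_subset_left)).trans_lt hfin.lt_top).ne
  -- Cutting with the ball adds dissipation only on `(G ∩ E) \ B_r`, at most `2c/h` per unit volume,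
  -- while perimeter drops by at least `(n-1)/R` per unit of removed volume.
  have h1 := hG.perimeter_le_add hE hP (F := G ∩ Metric.ball 0 r)
    (T := (G ∩ E) \ Metric.ball 0 r) (hG.1.inter hBm) (by
      rintro x (⟨⟨hx, -⟩, hx'⟩ | ⟨hx, hx'⟩)
      · exact Or.inl (Or.inl ⟨hx, hx'⟩)
      · by_cases hxG : x ∈ G
        · exact Or.inr ⟨⟨hxG, hx⟩, fun hxB => hx' ⟨hxG, hxB⟩⟩
        · exact Or.inl (Or.inr ⟨hx, hxG⟩))
  have h2 := dissipation_le (E := E) hh ((hG.1.inter hE).diff hBm) hfin' (c := 2 * c)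
    (by positivity) (fun x hx => infEDist_frontier_le hr hc hER hx.1.2 (by
      simpa using hx.2))
  have h3 := perimeter_inter_ball_le hn hr hrR hG.1 hPG hGR
  set V := volume.real (G \ Metric.ball 0 r) with hV
  have hVle : volume.real ((G ∩ E) \ Metric.ball 0 r) ≤ V :=
    measureReal_mono (sdiff_subset_sdiff_left inter_subset_left) hfin
  have h4 : ENNReal.ofReal ((n - 1) / R * V) ≤ ENNReal.ofReal (2 * c / h * V) := by
    have hfinI : perimeter (G ∩ Metric.ball 0 r) ≠ ∞ :=
      ((le_self_add.trans h3).trans_lt hPG.lt_top).ne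
    refine (ENNReal.add_le_add_iff_left hfinI).1 (h3.trans (h1.trans (add_le_add le_rfl ?_)))
    refine h2.trans (ENNReal.ofReal_le_ofReal ?_)
    gcongr
  have hV0 : volume (G \ Metric.ball 0 r) = 0 := by
    by_contra hne
    have hpos : 0 < V := ENNReal.toReal_pos hne hfin
    have hc' : 0 < 2 * c / h := by positivity
    have h5 := (ENNReal.ofReal_lt_ofReal_iff (mul_pos (hc'.trans hcR) hpos)).2
      (mul_lt_mul_of_pos_right hcR hpos)
    exact absurd h4 (not_le.2 h5)
  intro x hx
  by_contra hxr
  refine hN.notMem_closure hG.1 (U := (Metric.closedBall (0 : Rn n) r)ᶜ)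
    Metric.isClosed_closedBall.isOpen_compl (measure_mono_null ?_ hV0) hxr (subset_closure hx)
  exact fun y hy => ⟨hy.1, fun hyb => hy.2 (Metric.ball_subset_closedBall hyb)⟩

end Extinction

/-! ### Iteration of the scheme -/

section Scheme

variable {n : ℕ} {h : ℝ}

/-- Every step of the scheme stays in a fixed compact set, is outward minimizing and contained in
the previous step. -/
theorem IsScheme.properties (hn : 2 ≤ n) (hh : 0 < h) {Ω K : Set (Rn n)} (hK : IsClosed K)
    {E : ℕ → Set (Rn n)} (hE : IsScheme h E) {δ : ℝ} (hδ : 0 < δ)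
    (hKΩ : Metric.thickening δ K ⊆ Ω) {C : ℝ}
    (hC : ∀ (E : Set (Rn n)) (x₀ : Rn n), NullMeasurableSet E → perimeter E ≠ ∞ →
      perimeter (E \ Metric.closedBall x₀ (δ / 2)) ≤
        perimeter E + ENNReal.ofReal (C * volume.real (E ∩ Metric.closedBall x₀ (δ / 2))))
    (hhC : h * C < δ / 2) (h0K : closure (E 0) ⊆ K) (h0 : IsOutwardMinimizing Ω (E 0))
    (h0N : IsNormalized (E 0)) (h0P : perimeter (E 0) ≠ ∞) :
    ∀ k, closure (E k) ⊆ K ∧ IsOutwardMinimizing Ω (E k) ∧ IsNormalized (E k) ∧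
      perimeter (E k) ≠ ∞ ∧ ∀ᵐ x, x ∈ E (k + 1) → x ∈ E k := by
  -- The same `K` serves every step: up to null sets the new set lies in `E k ∪ ∂(E k)`, hence in
  -- `K`, and normalization makes this pointwise. So the smallness condition on `h` does not depend
  -- on `k`.
  have key : ∀ k, closure (E k) ⊆ K → IsOutwardMinimizing Ω (E k) → IsNormalized (E k) →
      perimeter (E k) ≠ ∞ → (closure (E (k + 1)) ⊆ K ∧ IsOutwardMinimizing Ω (E (k + 1)) ∧
        perimeter (E (k + 1)) ≠ ∞) ∧ ∀ᵐ x, x ∈ E (k + 1) → x ∈ E k := by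
    intro k a1 a2 a3 a4
    have hG : IsStepMinimizer h (E (k + 1)) (E k) := ⟨(hE k).1, (hE k).2.2⟩
    have hGN := (hE k).2.1
    have hGΩ : ∀ᵐ x, x ∈ E (k + 1) → x ∈ Ω :=
      (hG.ae_mem_thickening a2.1 a4 hh a1 hδ hC hhC).mono fun x hx hxG => hKΩ (hx hxG)
    have hKG := a2.perimeter_inter_le a4 hG.1 hGΩ
    have hfr := hG.ae_mem_frontier hh a2.1 a4 hKG
    have hGK : closure (E (k + 1)) ⊆ K := by
      intro x hx
      by_contra hxK
      refine hGN.notMem_closure hG.1 hK.isOpen_compl ?_ hxK hx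
      rw [measure_eq_zero_iff_ae_notMem]
      filter_upwards [hfr] with y hy hy'
      refine hy'.2 (a1 ?_)
      by_cases hyE : y ∈ E k
      · exact subset_closure hyE
      · exact frontier_subset_closure (hy hy'.1 hyE)
    have hGΩ' : E (k + 1) ⊆ Ω := subset_closure.trans
      (hGK.trans ((Metric.self_subset_thickening hδ K).trans hKΩ))
    exact ⟨⟨hGK, hG.isOutwardMinimizing a2 a4 hGΩ',
      ((hG.perimeter_le a2.1).trans_lt a4.lt_top).ne⟩,
      hG.ae_subset hn hh a2.1 a3 a4 hfr hKG⟩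
  have base : ∀ k, closure (E k) ⊆ K ∧ IsOutwardMinimizing Ω (E k) ∧ IsNormalized (E k) ∧
      perimeter (E k) ≠ ∞ := by
    intro k
    induction k with
    | zero => exact ⟨h0K, h0, h0N, h0P⟩
    | succ k ih =>
      obtain ⟨⟨b1, b2, b3⟩, -⟩ := key k ih.1 ih.2.1 ih.2.2.1 ih.2.2.2
      exact ⟨b1, b2, (hE k).2.1, b3⟩
  intro k
  obtain ⟨c1, c2, c3, c4⟩ := base k
  exact ⟨c1, c2, c3, c4, (key k c1 c2 c3 c4).2⟩

/-- The scheme becomes extinct after finitely many steps. -/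
theorem IsScheme.exists_extinction (hn : 2 ≤ n) (hh : 0 < h) {E : ℕ → Set (Rn n)}
    (hE : IsScheme h E) (hm : ∀ k, NullMeasurableSet (E k)) (hN : ∀ k, IsNormalized (E k))
    (hP : ∀ k, perimeter (E k) ≠ ∞) {R : ℝ} (hR : 0 < R)
    (hER : ∀ k, E k ⊆ Metric.closedBall 0 R) : ∃ N, ∀ k, N ≤ k → E k = ∅ := by
  have hn1 : (1 : ℝ) ≤ (n : ℝ) - 1 := by
    have : (2 : ℝ) ≤ n := by exact_mod_cast hn
    linarith
  -- Makes `2c/h = 1/(2R)`, which is less than `(n-1)/R`.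
  let c : ℝ := h / (4 * R)
  have hc : 0 < c := by positivity
  have hcR : 2 * c / h < (n - 1) / R := by
    have : 2 * c / h = 1 / 2 / R := by simp only [c]; field_simp; norm_num
    rw [this]
    gcongr
    linarith
  -- Quantifying over all positive `r ≥ R - kc` keeps the statement meaningful after `R - kc`
  -- becomes negative; then every positive radius is allowed and only the origin can remain.
  have key : ∀ k : ℕ, ∀ r : ℝ, 0 < r → R - k * c ≤ r → E k ⊆ Metric.closedBall 0 r := by
    intro k
    induction k with
    | zero =>
      intro r _ hr
      exact (hER 0).trans (Metric.closedBall_subset_closedBall (by simpa using hr))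
    | succ k ih =>
      intro r hr0 hr
      rcases le_total R r with hRr | hRr
      · exact (hER _).trans (Metric.closedBall_subset_closedBall hRr)
      · have hG : IsStepMinimizer h (E (k + 1)) (E k) := ⟨(hE k).1, (hE k).2.2⟩
        refine hG.subset_closedBall (by omega) hh (hm k) (hP k) (hN _) hr0 hRr hc hcR
          (ih (r + c) (by linarith) ?_) (hER _)
        push_cast at hr
        linarith
  obtain ⟨N, hN'⟩ := exists_nat_ge (R / c)
  refine ⟨N, fun k hk => ?_⟩
  have hkc : R ≤ k * c := by
    rw [← div_le_iff₀ hc]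
    exact hN'.trans (by exact_mod_cast hk)
  have h0 : E k ⊆ {0} := fun x hx => by
    by_contra hx0
    have hx' : 0 < ‖x‖ := norm_pos_iff.2 hx0
    have := key k (‖x‖ / 2) (by positivity) (by linarith) hx
    rw [mem_closedBall_zero_iff] at this
    linarith
  have : NeZero n := ⟨by omega⟩
  have hz : volume (E k) = 0 := measure_mono_null h0 (measure_singleton _)
  rw [← subset_empty_iff]
  intro x hx
  exact (hN k).notMem_closure (hm k) isOpen_univ (by simpa using hz) (mem_univ x)
    (subset_closure hx)

theorem arrivalTime_eq_sum {E : ℕ → Set (Rn n)} {N : ℕ} (hN : ∀ k, N ≤ k → E k = ∅)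
    (hh : 0 ≤ h) (x : Rn n) : arrivalTime h E x < ∞ ∧ (arrivalTime h E x).toReal =
      ∑ k ∈ Finset.range N, h * (E k).indicator (fun _ => (1 : ℝ)) x := by
  have h1 : ∑' k : ℕ, (E k).indicator (fun _ => (1 : ℝ≥0∞)) x =
      ∑ k ∈ Finset.range N, (E k).indicator (fun _ => (1 : ℝ≥0∞)) x :=
    tsum_eq_sum fun k hk => by
      rw [hN k (by simpa using hk)]; simp
  have h2 : ∀ k, (E k).indicator (fun _ => (1 : ℝ≥0∞)) x ≠ ∞ := fun k => by
    by_cases hx : x ∈ E k <;> simp [hx]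
  unfold arrivalTime
  rw [h1]
  refine ⟨ENNReal.mul_lt_top ENNReal.ofReal_lt_top (ENNReal.sum_lt_top.2 fun k _ => (h2 k).lt_top), ?_⟩
  rw [ENNReal.toReal_mul, ENNReal.toReal_ofReal hh, ENNReal.toReal_sum fun k _ => h2 k,
    Finset.mul_sum]
  refine Finset.sum_congr rfl fun k _ => ?_
  by_cases hx : x ∈ E k <;> simp [hx]

end Scheme

end ATW

/-! ### Outward minimality of the arrival time -/

open ATW in
theorem lemma3p2 {n : ℕ} (hn : 2 ≤ n) (Ω E₀ : Set (ATW.Rn n))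
    (hcpt : IsCompact (closure E₀)) (hsub : closure E₀ ⊆ interior Ω)
    (hnorm : ATW.IsNormalized E₀) (hmin : ATW.IsOutwardMinimizing Ω E₀) :
    ∃ h₀ : ℝ, 0 < h₀ ∧ ∀ h : ℝ, 0 < h → h < h₀ →
      ∀ E : ℕ → Set (ATW.Rn n), E 0 = E₀ → ATW.IsScheme h E →
        (∀ x, ATW.arrivalTime h E x < ∞) ∧
        ATW.MemBV (fun x => (ATW.arrivalTime h E x).toReal) ∧
        ∀ v : ATW.Rn n → ℝ, ATW.MemBV v →
          (∀ᵐ x, (ATW.arrivalTime h E x).toReal ≤ v x) →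
          (∀ᵐ x, x ∉ Ω → v x = 0) →
          ATW.totalVariation (fun x => (ATW.arrivalTime h E x).toReal) ≤
            ATW.totalVariation v := by
  obtain ⟨δ, hδ, hδΩ⟩ := hcpt.exists_thickening_subset_open isOpen_interior hsub
  obtain ⟨C, hC0, hC⟩ := exists_perimeter_diff_ball_le n (half_pos hδ)
  obtain ⟨R, hR⟩ := hcpt.isBounded.subset_closedBall (0 : Rn n)
  -- Below this threshold `C < δ/(2h)`, so deleting far balls is profitable.
  refine ⟨δ / 2 / C, by positivity, fun h hh hhh E hE0 hE => ?_⟩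
  have hhC : h * C < δ / 2 := (lt_div_iff₀ hC0).1 hhh
  have hprop := hE.properties hn hh isClosed_closure hδ (hδΩ.trans interior_subset) hC hhC
    (by rw [hE0]) (hE0 ▸ hmin) (hE0 ▸ hnorm)
    (by rw [hE0]; exact hmin.perimeter_ne_top hcpt hsub)
  have hm : ∀ k, NullMeasurableSet (E k) := fun k => (hprop k).2.1.1
  have hER : ∀ k, E k ⊆ Metric.closedBall 0 (max R 1) := fun k =>
    (subset_closure.trans (hprop k).1).trans
      (hR.trans (Metric.closedBall_subset_closedBall (le_max_left _ _)))
  obtain ⟨N, hN⟩ := hE.exists_extinction hn hh hm (fun k => (hprop k).2.2.1)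
    (fun k => (hprop k).2.2.2.1) (R := max R 1) (by positivity) hER
  have hu : (fun x => (arrivalTime h E x).toReal) =
      fun x => ∑ k ∈ Finset.range N, h * (E k).indicator (fun _ => (1 : ℝ)) x :=
    funext fun x => (arrivalTime_eq_sum hN hh.le x).2
  have hint : ∀ k, Integrable fun x => h * (E k).indicator (fun _ => (1 : ℝ)) x := fun k =>
    ((integrableOn_const ((measure_mono (hER k)).trans_lt
      Metric.isBounded_closedBall.measure_lt_top).ne).integrable_indicator₀ (hm k)).const_mul h
  have hTV : totalVariation (fun x => (arrivalTime h E x).toReal) ≤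
      ∑ k ∈ Finset.range N, ENNReal.ofReal h * perimeter (E k) := by
    rw [hu]
    refine (totalVariation_sum_le _ fun k _ => (hint k).locallyIntegrable).trans
      (Finset.sum_le_sum fun k _ => ?_)
    rw [perimeter_eq_totalVariation (hm k)]
    exact totalVariation_const_mul_le hh.le _
  refine ⟨fun x => (arrivalTime_eq_sum hN hh.le x).1, ⟨?_, ?_⟩, fun v hv huv hv0 => ?_⟩
  · rw [hu]
    exact integrable_finsetSum _ fun k _ => hint k
  · refine hTV.trans_lt (ENNReal.sum_lt_top.2 fun k _ =>
      ENNReal.mul_lt_top ENNReal.ofReal_lt_top ((hprop k).2.2.2.1).lt_top)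
  · refine hTV.trans ((sum_le_lintegral hh (g := fun t => perimeter {x | t < v x}) ?_).trans
      (lintegral_perimeter_le hv.1.locallyIntegrable))
    -- On the cell `hj ≤ t < h(j+1)` the set `{v > t}` competes with `E j`.
    intro j hj t ht1 ht2
    have ht0 : 0 ≤ t := le_trans (by positivity) ht1
    have hnest : ∀ᵐ x, ∀ k, x ∈ E (k + 1) → x ∈ E k := ae_all_iff.2 fun k => (hprop k).2.2.2.2
    refine (hprop j).2.1.perimeter_le
      (nullMeasurableSet_superlevel hv.1.locallyIntegrable t) ?_ ?_
    · filter_upwards [hnest, huv] with x hx1 hx2 hxj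
      -- A point of `E j` lies in all `j + 1` sets `E 0, …, E j`, so `v ≥ u_h ≥ h(j+1) > t` there.
      have hall : ∀ i, i ≤ j → x ∈ E i := fun i hi =>
        Nat.decreasingInduction (motive := fun i _ => x ∈ E i) (fun k _ hk => hx1 k hk) hxj hi
      refine lt_of_lt_of_le ht2 (le_trans ?_ hx2)
      rw [(arrivalTime_eq_sum hN hh.le x).2]
      calc h * ((j : ℝ) + 1) = ∑ k ∈ Finset.range (j + 1), h * (E k).indicator (fun _ => (1 : ℝ)) x := by
            rw [Finset.sum_congr rfl fun k hk => by
              rw [indicator_of_mem (hall k (Nat.lt_succ_iff.1 (Finset.mem_range.1 hk)))]]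
            simp
            ring
        _ ≤ _ := Finset.sum_le_sum_of_subset_of_nonneg
            (Finset.range_subset_range.2 hj) fun k _ _ =>
              mul_nonneg hh.le (indicator_nonneg (fun _ _ => zero_le_one) x)
    · filter_upwards [hv0] with x hx hxt
      by_contra hxΩ
      have hxt' : t < v x := hxt
      rw [hx hxΩ] at hxt'
      linarith
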